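/- \textbf{Theorem (kernel of the age-dependent process).} Let $\chi=\{1,\dots,k\}\subset\mathbb R$ and, for $i\neq j$ in $\chi$, let $\lambda_{ij}:(0,\infty)\to[0,\infty)$ be measurable with $\sup_{y>0}\sum_{j\ne i}\lambda_{ij}(y)<\infty$ and $\Lambda_i(y):=\int_0^y\sum_{j\neq i}\lambda_{ij}(v)\,dv\to\infty$ as $y\to\infty$, for every $i\in\chi$. For $y>0$ let $\Lambda_{ij}(y)$, $i\ne j$, be the consecutive (in the lexicographical order of the pairs $(i,j)$, starting at $0$) left-closed, right-open intervals of length $\lambda_{ij}(y)$, and put $$h(i,y,z)=\sum_{j\neq i}(j-i)\mathbf 1_{\Lambda_{ij}(y)}(z),\qquad g(i,y,z)=y\sum_{j\ne i}\mathbf 1_{\Lambda_{ij}(y)}(z).$$ Let $(\Omega,\mathcal F,\{\mathcal F_t\}_{t\ge0},P)$ be a filtered probability space and $\wp$ a Poisson random measure on $\mathbb R_+\times\mathbb R$ with intensity $du\times dz$ such that, for each $t\ge 0$, $\wp((0,t]\times B)$ is $\mathcal F_t$-measurable for every Borel set $B\subseteq\mathbb R$, and the restriction of $\wp$ to $(t,\infty)\times\mathbb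 R$ is independent of $\mathcal F_t$. Let $(X_t,Y_t)_{t\geq 0}$ be a strong solution, that is, an $\mathcal F_t$-adapted process with values in $\chi\times[0,\infty)$ and almost surely right-continuous paths with left limits, such that almost surely, for all $t\ge0$, $$X_t=X_0+\int_{(0,t]}\int_{\mathbb R}h(X_{u-},Y_{u-},z)\,\wp(du,dz),\qquad Y_t=Y_0+t-\int_{(0,t]}\int_{\mathbb R}g(X_{u-},Y_{u-},z)\,\wp(du,dz),$$ both integrals being absolutely convergent. Then, almost surely, the set $\{t>0:X_t\ne X_{t-}\}$ of transition times is infinite and is enumerated by an increasing sequence $0<T_1<T_2<\cdots$. Moreover, let $n\ge0$ be an integer and, if $n=0$, assume that $Y_0=0$ almost surely and put $T_0=0$. Then for all $i\ne j$ in $\chi$ with $P[X_{T_n}=i]>0$ and all $y>0$, $$Q_{ij}(y):=P[X_{T_{n+1}}=j,\;Y_{T_{n+1}-}\le y\mid X_{T_n}=i]=\int_0^y e^{-\Lambda_i(s)}\lambda_{ij}(s)\,ds .$$ -/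

import Mathlib

open MeasureTheory ProbabilityTheory Filter Set
open scoped NNReal ENNReal Topology

noncomputable section

namespace AgeDependent

/-! ### Transition rates -/

/-- The state space is `χ = {1, …, k}`, indexed by `Fin k`; `label i` is the real number in
`{1, …, k}` that the index `i` stands for. -/
def label {k : ℕ} (i : Fin k) : ℝ := (i : ℕ) + 1

/-- The total rate `∑_{j ≠ i} λ_ij(y)` of leaving the state `i` at age `y`. -/
def exitRate {k : ℕ} (lam : Fin k → Fin k → ℝ → ℝ) (i : Fin k) (y : ℝ) : ℝ :=
  ∑ j ∈ Finset.univ.filter (fun j => j ≠ i), lam i j y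

/-- The cumulative rate `Λ_i(y) = ∫_0^y ∑_{j ≠ i} λ_ij(v) dv`. -/
def cumRate {k : ℕ} (lam : Fin k → Fin k → ℝ → ℝ) (i : Fin k) (y : ℝ) : ℝ :=
  ∫ v in (0 : ℝ)..y, exitRate lam i v

/-- Admissible transition rates. Only the values `λ_ij(y)` with `i ≠ j` and `y > 0` matter. -/
structure IsRate {k : ℕ} (lam : Fin k → Fin k → ℝ → ℝ) : Prop where
  measurable : ∀ i j, i ≠ j → Measurable (fun y : Ioi (0 : ℝ) => lam i j y)
  nonneg : ∀ i j, i ≠ j → ∀ y, 0 < y → 0 ≤ lam i j y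
  bounded : ∀ i, BddAbove (exitRate lam i '' Ioi 0)
  tendsto_cumRate : ∀ i, Tendsto (cumRate lam i) atTop atTop

/-- The left end point of `Λ_ij(y)`: the total length of the intervals `Λ_ab(y)`, `a ≠ b`, whose
index pair `(a, b)` precedes `(i, j)` lexicographically. -/
def rateStart {k : ℕ} (lam : Fin k → Fin k → ℝ → ℝ) (i j : Fin k) (y : ℝ) : ℝ :=
  ∑ p ∈ Finset.univ.filter
    (fun p : Fin k × Fin k => p.1 ≠ p.2 ∧ (p.1 < i ∨ (p.1 = i ∧ p.2 < j))), lam p.1 p.2 y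

/-- The left-closed, right-open interval `Λ_ij(y)` of length `λ_ij(y)`; these intervals
are consecutive in the lexicographical ordering of the pairs `(i, j)`, starting at `0`. -/
def rateInterval {k : ℕ} (lam : Fin k → Fin k → ℝ → ℝ) (i j : Fin k) (y : ℝ) : Set ℝ :=
  Ico (rateStart lam i j y) (rateStart lam i j y + lam i j y)

/-- `h(i, y, z) = ∑_{j ≠ i} (j - i) 1_{Λ_ij(y)}(z)`. -/
def hFun {k : ℕ} (lam : Fin k → Fin k → ℝ → ℝ) (i : Fin k) (y z : ℝ) : ℝ :=
  ∑ j ∈ Finset.univ.filter (fun j => j ≠ i),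
    (label j - label i) * (rateInterval lam i j y).indicator (fun _ => (1 : ℝ)) z

/-- `g(i, y, z) = y ∑_{j ≠ i} 1_{Λ_ij(y)}(z)`. -/
def gFun {k : ℕ} (lam : Fin k → Fin k → ℝ → ℝ) (i : Fin k) (y z : ℝ) : ℝ :=
  y * ∑ j ∈ Finset.univ.filter (fun j => j ≠ i),
    (rateInterval lam i j y).indicator (fun _ => (1 : ℝ)) z

/-! ### Poisson random measures -/

/-- `N` is a Poisson random measure on `E` with mean measure `μ`: a random measure with values in
`{0, 1, 2, …, ∞}`, with Poisson counts, independent on disjoint sets. The measurable space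
`Measure E` carries the smallest σ-algebra that makes all evaluations on measurable sets
measurable. -/
structure IsPoissonRandomMeasure {Ω E : Type*} [MeasurableSpace Ω] [MeasurableSpace E]
    (N : Ω → Measure E) (μ : Measure E) (P : Measure Ω) : Prop where
  measurable : Measurable N
  integer_valued : ∀ ω, ∀ A : Set E, MeasurableSet A → N ω A = ∞ ∨ ∃ n : ℕ, N ω A = n
  count_of_finite : ∀ A : Set E, MeasurableSet A → μ A ≠ ∞ → ∀ n : ℕ,
    P {ω | N ω A = n} =
      ENNReal.ofReal (Real.exp (-(μ A).toReal) * (μ A).toReal ^ n / (n.factorial : ℝ))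
  count_of_infinite : ∀ A : Set E, MeasurableSet A → μ A = ∞ → ∀ n : ℕ,
    P {ω | N ω A = n} = 0
  indep : ∀ (m : ℕ) (A : Fin m → Set E), (∀ r, MeasurableSet (A r)) →
    Pairwise (fun r s => Disjoint (A r) (A s)) → iIndepFun (fun r ω => N ω (A r)) P

/-- Lebesgue measure `du × dz` on `ℝ₊ × ℝ`. -/
def intensity : Measure (ℝ≥0 × ℝ) :=
  (volume : Measure (ℝ × ℝ)).comap (fun p : ℝ≥0 × ℝ => ((p.1 : ℝ), p.2))

/-- `N` is a Poisson random measure on `ℝ₊ × ℝ` with intensity `du × dz`, relative to the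
filtration `ℱ`: it is adapted, and after each time `t` it is independent of `ℱ_t`. -/
structure IsPoissonRelTo {Ω : Type*} [mΩ : MeasurableSpace Ω]
    (N : Ω → Measure (ℝ≥0 × ℝ)) (ℱ : Filtration ℝ≥0 mΩ) (P : Measure Ω) : Prop where
  poisson : IsPoissonRandomMeasure N intensity P
  adapted : ∀ (t : ℝ≥0) (B : Set ℝ), MeasurableSet B →
    Measurable[ℱ t] (fun ω => N ω (Ioc 0 t ×ˢ B))
  indep_future : ∀ t : ℝ≥0, Indep (ℱ t)
    (MeasurableSpace.comap (fun ω => (N ω).restrict (Ioi t ×ˢ (univ : Set ℝ))) inferInstance) P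

/-! ### The stochastic integral equations and the transition times -/

/-- A right-continuous path with left limits. -/
def IsCadlag {β : Type*} [TopologicalSpace β] (f : ℝ≥0 → β) : Prop :=
  (∀ t, ContinuousWithinAt f (Ici t) t) ∧ ∀ t, 0 < t → ∃ l, Tendsto f (𝓝[<] t) (𝓝 l)

/-- `(X, Y)`, with values in `χ × ℝ₊`, is a strong solution driven by `N` of
`X_t = X_0 + ∫_{(0,t]} ∫_ℝ h(X_{u-}, Y_{u-}, z) N(du, dz)` and
`Y_t = Y_0 + t - ∫_{(0,t]} ∫_ℝ g(X_{u-}, Y_{u-}, z) N(du, dz)`. -/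
structure IsStrongSolution {Ω : Type*} [mΩ : MeasurableSpace Ω] {k : ℕ}
    (lam : Fin k → Fin k → ℝ → ℝ) (N : Ω → Measure (ℝ≥0 × ℝ)) (ℱ : Filtration ℝ≥0 mΩ)
    (P : Measure Ω) (X : ℝ≥0 → Ω → Fin k) (Y : ℝ≥0 → Ω → ℝ) : Prop where
  adapted_X : Adapted ℱ X
  adapted_Y : Adapted ℱ Y
  nonneg_Y : ∀ᵐ ω ∂P, ∀ t, 0 ≤ Y t ω
  cadlag_X : ∀ᵐ ω ∂P, IsCadlag (fun t => X t ω)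
  cadlag_Y : ∀ᵐ ω ∂P, IsCadlag (fun t => Y t ω)
  eq_X : ∀ᵐ ω ∂P, ∀ t : ℝ≥0,
    IntegrableOn (fun p : ℝ≥0 × ℝ => hFun lam (Function.leftLim (fun u => X u ω) p.1)
      (Function.leftLim (fun u => Y u ω) p.1) p.2) (Ioc 0 t ×ˢ univ) (N ω) ∧
    label (X t ω) = label (X 0 ω) +
      ∫ p in Ioc 0 t ×ˢ (univ : Set ℝ), hFun lam (Function.leftLim (fun u => X u ω) p.1)
        (Function.leftLim (fun u => Y u ω) p.1) p.2 ∂(N ω)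
  eq_Y : ∀ᵐ ω ∂P, ∀ t : ℝ≥0,
    IntegrableOn (fun p : ℝ≥0 × ℝ => gFun lam (Function.leftLim (fun u => X u ω) p.1)
      (Function.leftLim (fun u => Y u ω) p.1) p.2) (Ioc 0 t ×ˢ univ) (N ω) ∧
    Y t ω = Y 0 ω + (t : ℝ) -
      ∫ p in Ioc 0 t ×ˢ (univ : Set ℝ), gFun lam (Function.leftLim (fun u => X u ω) p.1)
        (Function.leftLim (fun u => Y u ω) p.1) p.2 ∂(N ω)

/-- The set `{t > 0 : X_t ≠ X_{t-}}` of transition times of a path. -/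
def transitionSet {β : Type*} [TopologicalSpace β] (x : ℝ≥0 → β) : Set ℝ≥0 :=
  {t | 0 < t ∧ x t ≠ Function.leftLim x t}

/-- `transitionTime x n` is the `n`-th transition time `T_n` of the path `x` for `n ≥ 1`, that is,
the first transition time after `T_{n-1}` (after time `0` if `n = 1`). The value at `n = 0` is the
time `0`; it is the time `T_0 = -Y_0` exactly when the initial age `Y_0` is `0`. -/
def transitionTime {β : Type*} [TopologicalSpace β] (x : ℝ≥0 → β) : ℕ → ℝ≥0
  | 0 => 0
  | n + 1 => sInf {t | t ∈ transitionSet x ∧ transitionTime x n < t}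

end AgeDependent

end

noncomputable section

namespace AgeDependent

/-! ### Rates and rate intervals -/

section Rates

variable {k : ℕ} {lam : Fin k → Fin k → ℝ → ℝ}

/-! The proof separates a pathwise analysis from one expectation identity. Pathwise: all relevant
marks lie in a bounded strip `[0, C)`, where almost surely the points of the random measure are
locally finite and no two share a time. Between transitions the state is constant and the age grows
with slope one. If a point at time `u` has its mark in `Λ_ij(Y_{u-})` while `X_{u-} = i`, the state
becomes `j` and the age drops to `0`; every transition arises in this way
(`PathSolution.eq_of_measure_ne_zero`, `PathSolution.hits_null`). Expectation: a predictable set of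
points has equal mean count and mean intensity (`lintegral_section`). Let `τ` be some `T_n`, `σ` the
next transition time and `D = σ - τ`, and take the points with mark in `Λ_ij` that realise the first
transition after `τ`, from state `i` and at age at most `y`. Their count is the indicator of the
event `{X_τ = i, X_σ = j, Y_{σ-} ≤ y}`. When `Y_τ = 0`, their intensity is `∫_0^y λ_ij(s) 1{X_τ = i,
s ≤ D} ds`. With `G(s) = P(X_τ = i, s ≤ D)` the event thus has probability `∫_0^y λ_ij G`. Summing
over `j` gives `G = P(X_τ = i) - ∫ r G`, where `r` is the exit rate of `i`, so `G = P(X_τ = i)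
exp(-Λ_i)` (`eq_mul_exp_of_eq_sub_integral`), and substituting this back gives the kernel. The same
identity without an age bound shows that another transition occurs: counts are at most one, so the
intensity is almost surely finite, whereas on a path without further transitions it is infinite for
some `j` because `Λ_i → ∞` (`ae_exists_transition`). The filtration need be neither complete nor
right-continuous, so no strong Markov property is invoked. Transition times are handled through
adapted events squeezed between `{τ < r}` and `{τ ≤ r}` (`IsEssStopping`), and everything is reduced
to a countable dense set of times. -/

lemma label_injective : Function.Injective (label : Fin k → ℝ) := by
  intro i j h
  simp only [label, add_left_inj, Nat.cast_inj] at h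
  exact Fin.ext h

lemma rateStart_nonneg (hlam : IsRate lam) (i j : Fin k) {y : ℝ} (hy : 0 < y) :
    0 ≤ rateStart lam i j y :=
  Finset.sum_nonneg fun _ hp => hlam.nonneg _ _ (Finset.mem_filter.1 hp).2.1 y hy

/-- The right end point is itself a sum of nonnegative rates, over the pairs up to and including
`(i, j)`. Disjointness and boundedness of the intervals both follow by choosing `s`. -/
lemma rateStart_add_le_sum (hlam : IsRate lam) {i j : Fin k} (hij : i ≠ j) {y : ℝ} (hy : 0 < y)
    {s : Finset (Fin k × Fin k)} (hs : ∀ p ∈ s, p.1 ≠ p.2)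
    (hlt : ∀ p : Fin k × Fin k, p.1 ≠ p.2 → p.1 < i ∨ (p.1 = i ∧ p.2 ≤ j) → p ∈ s) :
    rateStart lam i j y + lam i j y ≤ ∑ p ∈ s, lam p.1 p.2 y := by
  classical
  have hnot : (i, j) ∉ Finset.univ.filter
      (fun p : Fin k × Fin k => p.1 ≠ p.2 ∧ (p.1 < i ∨ (p.1 = i ∧ p.2 < j))) := by simp
  have h := Finset.sum_insert (f := fun p : Fin k × Fin k => lam p.1 p.2 y) hnot
  rw [rateStart, add_comm, ← h]
  refine Finset.sum_le_sum_of_subset_of_nonneg ?_ fun p hp _ => hlam.nonneg _ _ (hs p hp) y hy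
  intro p hp
  rcases Finset.mem_insert.1 hp with rfl | hp
  · exact hlt _ hij (Or.inr ⟨rfl, le_rfl⟩)
  · obtain ⟨h1, h2⟩ := (Finset.mem_filter.1 hp).2
    exact hlt p h1 (h2.imp_right fun h => ⟨h.1, h.2.le⟩)

lemma rateStart_add_le (hlam : IsRate lam) {i j l : Fin k} (hij : i ≠ j) (hjl : j < l) {y : ℝ}
    (hy : 0 < y) : rateStart lam i j y + lam i j y ≤ rateStart lam i l y := by
  refine rateStart_add_le_sum hlam hij hy (fun p hp => (Finset.mem_filter.1 hp).2.1) ?_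
  intro p hp h
  exact Finset.mem_filter.2 ⟨Finset.mem_univ _, hp, h.imp_right fun h => ⟨h.1, h.2.trans_lt hjl⟩⟩

lemma disjoint_rateInterval (hlam : IsRate lam) {i j l : Fin k} (hij : i ≠ j) (hil : i ≠ l)
    (hjl : j ≠ l) {y : ℝ} (hy : 0 < y) :
    Disjoint (rateInterval lam i j y) (rateInterval lam i l y) := by
  rw [rateInterval, rateInterval, Set.Ico_disjoint_Ico]
  rcases lt_or_gt_of_ne hjl with h | h
  · exact (min_le_left _ _).trans ((rateStart_add_le hlam hij h hy).trans (le_max_right _ _))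
  · exact (min_le_right _ _).trans ((rateStart_add_le hlam hil h hy).trans (le_max_left _ _))

lemma volume_rateInterval (i j : Fin k) (y : ℝ) :
    volume (rateInterval lam i j y) = ENNReal.ofReal (lam i j y) := by
  simp [rateInterval]

lemma sum_exitRate (y : ℝ) :
    ∑ p ∈ Finset.univ.filter (fun p : Fin k × Fin k => p.1 ≠ p.2), lam p.1 p.2 y
      = ∑ i, exitRate lam i y := by
  classical
  simp only [exitRate, Finset.sum_filter]
  rw [← Finset.univ_product_univ, Finset.sum_product]
  simp [ne_comm]

lemma exists_rateBound (hlam : IsRate lam) :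
    ∃ C : ℝ, 0 < C ∧ ∀ i j, i ≠ j → ∀ y, 0 < y → rateInterval lam i j y ⊆ Ico 0 C := by
  choose b hb using hlam.bounded
  -- All intervals together have length at most the sum of the exit-rate bounds; the maximum with
  -- `1` only secures positivity.
  refine ⟨max 1 (∑ i, b i), lt_max_of_lt_left one_pos, fun i j hij y hy => ?_⟩
  refine Set.Ico_subset_Ico (rateStart_nonneg hlam i j hy) ?_
  refine le_trans ?_ (le_max_right _ _)
  refine (rateStart_add_le_sum hlam hij hy (s := Finset.univ.filter (fun p => p.1 ≠ p.2))
    (by simp) (by simp +contextual)).trans ?_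
  rw [sum_exitRate]
  exact Finset.sum_le_sum fun i _ => hb i ⟨y, hy, rfl⟩

/-- The rates, set to `0` where they do not matter. -/
def posRate (lam : Fin k → Fin k → ℝ → ℝ) (i j : Fin k) : ℝ → ℝ :=
  (Ioi (0 : ℝ)).indicator (lam i j)

lemma posRate_of_pos {i j : Fin k} {y : ℝ} (hy : 0 < y) : posRate lam i j y = lam i j y :=
  indicator_of_mem (mem_Ioi.2 hy) _

/-- Measurability is assumed on the subtype of positive ages only; extending by zero gives a
function measurable on the whole line. -/
lemma measurable_posRate (hlam : IsRate lam) {i j : Fin k} (hij : i ≠ j) :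
    Measurable (posRate lam i j) := by
  refine measurable_of_restrict_of_restrict_compl (measurableSet_Ioi (a := (0 : ℝ))) ?_ ?_
  · convert hlam.measurable i j hij using 1
    ext y
    simp only [domRestrict_apply]
    exact posRate_of_pos y.2
  · convert measurable_const (a := (0 : ℝ)) using 1
    ext y
    simp only [domRestrict_apply]
    exact indicator_of_notMem y.2 _

lemma rateStart_eq_posRate {i j : Fin k} {y : ℝ} (hy : 0 < y) :
    rateStart lam i j y = rateStart (posRate lam) i j y := by
  refine Finset.sum_congr rfl fun p _ => ?_
  rw [posRate_of_pos hy]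

lemma measurable_rateStart_posRate (hlam : IsRate lam) (i j : Fin k) :
    Measurable (rateStart (posRate lam) i j) := by
  unfold rateStart
  exact Finset.measurable_sum _ fun p hp =>
    measurable_posRate hlam (Finset.mem_filter.1 hp).2.1

lemma measurableSet_mem_rateInterval (hlam : IsRate lam) {i j : Fin k} (hij : i ≠ j) :
    MeasurableSet {p : ℝ × ℝ | 0 < p.1 ∧ p.2 ∈ rateInterval lam i j p.1} := by
  have h : {p : ℝ × ℝ | 0 < p.1 ∧ p.2 ∈ rateInterval lam i j p.1} =
      {p : ℝ × ℝ | 0 < p.1} ∩ ({p | rateStart (posRate lam) i j p.1 ≤ p.2} ∩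
        {p | p.2 < rateStart (posRate lam) i j p.1 + posRate lam i j p.1}) := by
    ext p
    simp only [mem_ofPred_eq, mem_inter_iff]
    refine and_congr_right fun hp => ?_
    rw [rateInterval, mem_Ico, rateStart_eq_posRate hp, posRate_of_pos hp]
  rw [h]
  have h1 : Measurable fun p : ℝ × ℝ => rateStart (posRate lam) i j p.1 :=
    (measurable_rateStart_posRate hlam i j).comp measurable_fst
  have h2 : Measurable fun p : ℝ × ℝ => posRate lam i j p.1 :=
    (measurable_posRate hlam hij).comp measurable_fst
  exact (measurableSet_lt measurable_const measurable_fst).inter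
    ((measurableSet_le h1 measurable_snd).inter (measurableSet_lt measurable_snd (h1.add h2)))

/-- The marks that make a path leave the state `i` at the age `y`. -/
def hitSet (lam : Fin k → Fin k → ℝ → ℝ) (i : Fin k) (y : ℝ) : Set ℝ :=
  ⋃ j ∈ {j | j ≠ i}, rateInterval lam i j y

lemma mem_hitSet {i : Fin k} {y z : ℝ} :
    z ∈ hitSet lam i y ↔ ∃ j, j ≠ i ∧ z ∈ rateInterval lam i j y := by
  simp [hitSet]

lemma hFun_eq_zero {i : Fin k} {y z : ℝ} (h : z ∉ hitSet lam i y) : hFun lam i y z = 0 := by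
  refine Finset.sum_eq_zero fun j hj => ?_
  rw [indicator_of_notMem, mul_zero]
  exact fun hz => h (mem_hitSet.2 ⟨j, (Finset.mem_filter.1 hj).2, hz⟩)

lemma gFun_eq_zero {i : Fin k} {y z : ℝ} (h : z ∉ hitSet lam i y) : gFun lam i y z = 0 := by
  rw [gFun, Finset.sum_eq_zero, mul_zero]
  refine fun j hj => indicator_of_notMem (fun hz => h ?_) _
  exact mem_hitSet.2 ⟨j, (Finset.mem_filter.1 hj).2, hz⟩

lemma sum_indicator_rateInterval (hlam : IsRate lam) {i j : Fin k} (hij : j ≠ i) {y z : ℝ}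
    (hy : 0 < y) (hz : z ∈ rateInterval lam i j y) (c : Fin k → ℝ) :
    ∑ l ∈ Finset.univ.filter (fun l => l ≠ i),
      c l * (rateInterval lam i l y).indicator (fun _ => (1 : ℝ)) z = c j := by
  rw [Finset.sum_eq_single_of_mem j (by simpa using hij), indicator_of_mem hz, mul_one]
  intro l hl hlj
  rw [indicator_of_notMem, mul_zero]
  exact fun h => Set.disjoint_left.1 (disjoint_rateInterval hlam (Finset.mem_filter.1 hl).2.symm
    hij.symm hlj hy) h hz

lemma hFun_of_mem (hlam : IsRate lam) {i j : Fin k} (hij : j ≠ i) {y z : ℝ}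
    (hy : 0 < y) (hz : z ∈ rateInterval lam i j y) : hFun lam i y z = label j - label i :=
  sum_indicator_rateInterval hlam hij hy hz fun l => label l - label i

lemma gFun_of_mem (hlam : IsRate lam) {i j : Fin k} (hij : j ≠ i) {y z : ℝ}
    (hy : 0 < y) (hz : z ∈ rateInterval lam i j y) : gFun lam i y z = y := by
  have h := sum_indicator_rateInterval hlam hij hy hz fun _ => 1
  simp only [one_mul] at h
  rw [gFun, h, mul_one]

lemma hitSet_subset {C : ℝ}
    (hC : ∀ i j, i ≠ j → ∀ y, 0 < y → rateInterval lam i j y ⊆ Ico 0 C) (i : Fin k) {y : ℝ}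
    (hy : 0 < y) : hitSet lam i y ⊆ Ico 0 C :=
  iUnion₂_subset fun j hj => hC i j (Ne.symm hj) y hy

end Rates

/-! ### Analysis of a single path -/

/-- A path `(x, y)` that solves the equations driven by the integer-valued measure `ν`, whose
points with marks in `[0, C)` are locally finite and simple in time. -/
structure PathSolution {k : ℕ} (lam : Fin k → Fin k → ℝ → ℝ) (C : ℝ) (ν : Measure (ℝ≥0 × ℝ))
    (x : ℝ≥0 → Fin k) (y : ℝ≥0 → ℝ) : Prop where
  integer_valued : ∀ A : Set (ℝ≥0 × ℝ), MeasurableSet A → ν A = ∞ ∨ ∃ n : ℕ, ν A = n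
  finite_strip : ∀ t, ν (Ioc 0 t ×ˢ Ico 0 C) ≠ ∞
  simple : ∀ u, 0 < u → ν ({u} ×ˢ Ico 0 C) ≤ 1
  nonneg : ∀ t, 0 ≤ y t
  cadlag_x : IsCadlag x
  cadlag_y : IsCadlag y
  eq_x : ∀ t : ℝ≥0,
    IntegrableOn (fun p : ℝ≥0 × ℝ => hFun lam (Function.leftLim x p.1)
      (Function.leftLim y p.1) p.2) (Ioc 0 t ×ˢ univ) ν ∧
    label (x t) = label (x 0) + ∫ p in Ioc 0 t ×ˢ (univ : Set ℝ),
      hFun lam (Function.leftLim x p.1) (Function.leftLim y p.1) p.2 ∂ν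
  eq_y : ∀ t : ℝ≥0,
    IntegrableOn (fun p : ℝ≥0 × ℝ => gFun lam (Function.leftLim x p.1)
      (Function.leftLim y p.1) p.2) (Ioc 0 t ×ˢ univ) ν ∧
    y t = y 0 + (t : ℝ) - ∫ p in Ioc 0 t ×ˢ (univ : Set ℝ),
      gFun lam (Function.leftLim x p.1) (Function.leftLim y p.1) p.2 ∂ν

lemma neBot_nhdsLT {u : ℝ≥0} (hu : 0 < u) : (𝓝[<] u).NeBot :=
  nhdsLT_neBot_of_exists_lt ⟨0, hu⟩

lemma setIntegral_Ioc_prod_add {f : ℝ≥0 × ℝ → ℝ} {ν : Measure (ℝ≥0 × ℝ)} {s t : ℝ≥0}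
    (hst : s ≤ t) (hf : IntegrableOn f (Ioc 0 t ×ˢ univ) ν) :
    ∫ p in Ioc 0 t ×ˢ (univ : Set ℝ), f p ∂ν =
      ∫ p in Ioc 0 s ×ˢ (univ : Set ℝ), f p ∂ν + ∫ p in Ioc s t ×ˢ (univ : Set ℝ), f p ∂ν := by
  have h : (Ioc 0 t ×ˢ univ : Set (ℝ≥0 × ℝ)) = Ioc 0 s ×ˢ univ ∪ Ioc s t ×ˢ univ := by
    rw [← union_prod, Ioc_union_Ioc_eq_Ioc (zero_le) hst]
  rw [h] at hf ⊢
  refine setIntegral_union ?_ (measurableSet_Ioc.prod .univ) hf.left_of_union hf.right_of_union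
  exact Disjoint.set_prod_left (Set.Ioc_disjoint_Ioc_of_le le_rfl) _ _

namespace PathSolution

variable {k : ℕ} {lam : Fin k → Fin k → ℝ → ℝ} {C : ℝ} {ν : Measure (ℝ≥0 × ℝ)}
  {x : ℝ≥0 → Fin k} {y : ℝ≥0 → ℝ}

lemma measure_eq_zero (hs : PathSolution lam C ν x y) {A : Set (ℝ≥0 × ℝ)} (hA : MeasurableSet A)
    (h : ν A < 1) : ν A = 0 := by
  rcases hs.integer_valued A hA with h' | ⟨n, h'⟩
  · simp [h'] at h
  · rw [h'] at h ⊢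
    have : n < 1 := by exact_mod_cast h
    simp [Nat.lt_one_iff.1 this]

/-- Continuity from above sends the masses to `0`, and an integer-valued measure below `1` vanishes.
Applied to one-sided punctured neighbourhoods of a time, this isolates the points of the strip. -/
lemma exists_null_of_antitone (hs : PathSolution lam C ν x y) {I : ℕ → Set ℝ≥0} {t : ℝ≥0}
    (hm : ∀ n, MeasurableSet (I n)) (hI : Antitone I) (h0 : I 0 ⊆ Ioc 0 t)
    (he : ⋂ n, I n = ∅) : ∃ n, ν (I n ×ˢ Ico 0 C) = 0 := by
  have hlim := tendsto_measure_iInter_atTop (μ := ν) (s := fun n => I n ×ˢ Ico (0 : ℝ) C)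
    (fun n => ((hm n).prod measurableSet_Ico).nullMeasurableSet)
    (fun m n hmn => Set.prod_mono_left (hI hmn))
    ⟨0, ((measure_mono (Set.prod_mono_left h0)).trans_lt (hs.finite_strip t).lt_top).ne⟩
  have he' : ⋂ n, I n ×ˢ Ico (0 : ℝ) C = ∅ := by
    refine eq_empty_of_forall_notMem fun p hp => ?_
    have hp' : p.1 ∈ ⋂ n, I n := mem_iInter.2 fun n => (mem_iInter.1 hp n).1
    rwa [he] at hp'
  rw [he', measure_empty] at hlim
  obtain ⟨n, hn⟩ := (hlim.eventually_lt_const one_pos).exists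
  exact ⟨n, hs.measure_eq_zero ((hm n).prod measurableSet_Ico) hn⟩

lemma exists_left_null (hs : PathSolution lam C ν x y) {u : ℝ≥0} (hu : 0 < u) :
    ∃ s < u, ν (Ioo s u ×ˢ Ico 0 C) = 0 := by
  obtain ⟨a, ha, hau, hlim⟩ := exists_seq_strictMono_tendsto' hu
  obtain ⟨n, hn⟩ := hs.exists_null_of_antitone (I := fun n => Ioo (a n) u) (t := u)
    (fun _ => measurableSet_Ioo) (fun m n hmn => Ioo_subset_Ioo_left (ha.monotone hmn))
    (fun v hv => ⟨(zero_le).trans_lt hv.1, hv.2.le⟩) (by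
      refine eq_empty_of_forall_notMem fun v hv => ?_
      have hv' := mem_iInter.1 hv
      exact (le_of_tendsto' hlim fun n => (hv' n).1.le).not_gt (hv' 0).2)
  exact ⟨a n, (hau n).2, hn⟩

lemma exists_right_null (hs : PathSolution lam C ν x y) (u : ℝ≥0) :
    ∃ v > u, ν (Ioo u v ×ˢ Ico 0 C) = 0 := by
  obtain ⟨a, ha, hau, hlim⟩ := exists_seq_strictAnti_tendsto' (lt_add_one u)
  obtain ⟨n, hn⟩ := hs.exists_null_of_antitone (I := fun n => Ioo u (a n)) (t := u + 1)
    (fun _ => measurableSet_Ioo) (fun m n hmn => Ioo_subset_Ioo_right (ha.antitone hmn))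
    (fun v hv => ⟨(zero_le).trans_lt hv.1, hv.2.le.trans (hau 0).2.le⟩) (by
      refine eq_empty_of_forall_notMem fun v hv => ?_
      have hv' := mem_iInter.1 hv
      exact (ge_of_tendsto' hlim fun n => (hv' n).2.le).not_gt (hv' 0).1)
  exact ⟨a n, (hau n).1, hn⟩

lemma label_eq_add (hs : PathSolution lam C ν x y) {s t : ℝ≥0} (hst : s ≤ t) :
    label (x t) = label (x s) + ∫ p in Ioc s t ×ˢ (univ : Set ℝ),
      hFun lam (Function.leftLim x p.1) (Function.leftLim y p.1) p.2 ∂ν := by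
  rw [(hs.eq_x t).2, setIntegral_Ioc_prod_add hst (hs.eq_x t).1, (hs.eq_x s).2, add_assoc]

lemma age_eq_add (hs : PathSolution lam C ν x y) {s t : ℝ≥0} (hst : s ≤ t) :
    y t = y s + (t - s : ℝ) - ∫ p in Ioc s t ×ˢ (univ : Set ℝ),
      gFun lam (Function.leftLim x p.1) (Function.leftLim y p.1) p.2 ∂ν := by
  rw [(hs.eq_y t).2, setIntegral_Ioc_prod_add hst (hs.eq_y t).1, (hs.eq_y s).2]
  ring

/-- The points of `ν` that make the path jump. -/
def hits (lam : Fin k → Fin k → ℝ → ℝ) (x : ℝ≥0 → Fin k) (y : ℝ≥0 → ℝ) : Set (ℝ≥0 × ℝ) :=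
  {p | 0 < p.1 ∧ p.2 ∈ hitSet lam (Function.leftLim x p.1) (Function.leftLim y p.1)}

lemma eq_of_hits_null (hs : PathSolution lam C ν x y) {s t : ℝ≥0} (hst : s ≤ t)
    (h : ν (Ioc s t ×ˢ univ ∩ hits lam x y) = 0) : x t = x s ∧ y t = y s + (t - s : ℝ) := by
  have hae : ∀ᵐ p ∂ν.restrict (Ioc s t ×ˢ univ),
      p.2 ∉ hitSet lam (Function.leftLim x p.1) (Function.leftLim y p.1) := by
    rw [ae_restrict_iff' (measurableSet_Ioc.prod .univ)]
    refine measure_mono_null (fun p hp => ?_) h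
    simp only [mem_compl_iff, mem_ofPred_eq, Classical.not_imp, not_not] at hp
    exact ⟨hp.1, (zero_le).trans_lt hp.1.1.1, hp.2⟩
  constructor
  · apply label_injective
    rw [hs.label_eq_add hst, integral_eq_zero_of_ae, add_zero]
    filter_upwards [hae] with p hp using hFun_eq_zero hp
  · rw [hs.age_eq_add hst, integral_eq_zero_of_ae, sub_zero]
    filter_upwards [hae] with p hp using gFun_eq_zero hp

lemma tendsto_leftLim_y (hs : PathSolution lam C ν x y) {u : ℝ≥0} (hu : 0 < u) :
    Tendsto y (𝓝[<] u) (𝓝 (Function.leftLim y u)) :=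
  tendsto_leftLim_of_tendsto (hs.cadlag_y.2 u hu)

lemma leftLim_nonneg (hs : PathSolution lam C ν x y) {u : ℝ≥0} (hu : 0 < u) :
    0 ≤ Function.leftLim y u :=
  have := neBot_nhdsLT hu
  ge_of_tendsto' (hs.tendsto_leftLim_y hu) hs.nonneg

lemma leftLim_eq {u s : ℝ≥0} (hsu : s < u) {i : Fin k} {a : ℝ}
    (h : ∀ t ∈ Ioo s u, x t = i ∧ y t = a + (t - s : ℝ)) :
    Function.leftLim x u = i ∧ Function.leftLim y u = a + (u - s : ℝ) := by
  have := neBot_nhdsLT ((zero_le).trans_lt hsu)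
  have hev : ∀ᶠ t in 𝓝[<] u, t ∈ Ioo s u := Ioo_mem_nhdsLT hsu
  constructor
  · refine leftLim_eq_of_tendsto (tendsto_const_nhds.congr' ?_)
    filter_upwards [hev] with t ht using (h t ht).1.symm
  · refine leftLim_eq_of_tendsto (Tendsto.congr' (f₁ := fun t : ℝ≥0 => a + (t - s : ℝ)) ?_ ?_)
    · filter_upwards [hev] with t ht using (h t ht).2.symm
    · refine Tendsto.mono_left (Continuous.tendsto' ?_ _ _ rfl) nhdsWithin_le_nhds
      fun_prop

/-- The inclusion of the hit set in the strip is known only at positive ages. At age `0` the factor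
`y` in `gFun` kills the integrand, so the age equation can be treated before positivity of the left
limits is available; that positivity is then deduced from it. -/
lemma age_eq_add_of_strip_null (hs : PathSolution lam C ν x y)
    (hC : ∀ i j, i ≠ j → ∀ y, 0 < y → rateInterval lam i j y ⊆ Ico 0 C) {s t : ℝ≥0}
    (hst : s ≤ t) (h : ν (Ioc s t ×ˢ Ico 0 C) = 0) : y t = y s + (t - s : ℝ) := by
  rw [hs.age_eq_add hst, integral_eq_zero_of_ae, sub_zero]
  rw [EventuallyEq, ae_restrict_iff' (measurableSet_Ioc.prod .univ)]
  refine measure_mono_null (fun p hp => ?_) h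
  simp only [mem_compl_iff, mem_ofPred_eq, Classical.not_imp] at hp
  have h0 : 0 < p.1 := (zero_le).trans_lt hp.1.1.1
  have hpos : 0 < Function.leftLim y p.1 := by
    refine (hs.leftLim_nonneg h0).lt_of_ne fun h0 => hp.2 ?_
    simp [gFun, ← h0]
  refine ⟨hp.1.1, hitSet_subset hC (Function.leftLim x p.1) hpos ?_⟩
  by_contra hz
  exact hp.2 (gFun_eq_zero hz)

/-- Just before `u` the strip is empty, so the age has been growing with slope one from a
nonnegative value. Hence the rates are never evaluated at age `0`. -/
lemma leftLim_pos (hs : PathSolution lam C ν x y)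
    (hC : ∀ i j, i ≠ j → ∀ y, 0 < y → rateInterval lam i j y ⊆ Ico 0 C) {u : ℝ≥0} (hu : 0 < u) :
    0 < Function.leftLim y u := by
  obtain ⟨s₀, hs₀, hnull⟩ := hs.exists_left_null hu
  obtain ⟨s, hs₁, hsu⟩ := exists_between hs₀
  have hlin : ∀ t ∈ Ioo s u, y t = y s + (t - s : ℝ) := fun t ht =>
    hs.age_eq_add_of_strip_null hC ht.1.le
      (measure_mono_null (Set.prod_mono_left (Ioc_subset_Ioo hs₁.le ht.2)) hnull)
  have h := (leftLim_eq (x := fun _ => x 0) hsu fun t ht => ⟨rfl, hlin t ht⟩).2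
  rw [h]
  have : (s : ℝ) < u := by exact_mod_cast hsu
  linarith [hs.nonneg s]

lemma hits_subset (hs : PathSolution lam C ν x y)
    (hC : ∀ i j, i ≠ j → ∀ y, 0 < y → rateInterval lam i j y ⊆ Ico 0 C) (I : Set ℝ≥0) :
    I ×ˢ univ ∩ hits lam x y ⊆ I ×ˢ Ico 0 C :=
  fun _ hp => ⟨hp.1.1, hitSet_subset hC _ (hs.leftLim_pos hC hp.2.1) hp.2.2⟩

lemma exists_before (hs : PathSolution lam C ν x y)
    (hC : ∀ i j, i ≠ j → ∀ y, 0 < y → rateInterval lam i j y ⊆ Ico 0 C) {u : ℝ≥0} (hu : 0 < u) :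
    ∃ s < u, ν (Ioo s u ×ˢ Ico 0 C) = 0 ∧ x s = Function.leftLim x u ∧
      y s = Function.leftLim y u - (u - s : ℝ) := by
  obtain ⟨s₀, hs₀, hnull⟩ := hs.exists_left_null hu
  obtain ⟨s, hs₁, hsu⟩ := exists_between hs₀
  have hlin : ∀ t ∈ Ioo s u, x t = x s ∧ y t = y s + (t - s : ℝ) := fun t ht =>
    hs.eq_of_hits_null ht.1.le (measure_mono_null ((hs.hits_subset hC _).trans
      (Set.prod_mono_left (Ioc_subset_Ioo hs₁.le ht.2))) hnull)
  have h := leftLim_eq hsu hlin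
  refine ⟨s, hsu, measure_mono_null (Set.prod_mono_left (Ioo_subset_Ioo_left hs₁.le)) hnull,
    h.1.symm, ?_⟩
  rw [h.2]
  ring

lemma eq_leftLim_of_null (hs : PathSolution lam C ν x y)
    (hC : ∀ i j, i ≠ j → ∀ y, 0 < y → rateInterval lam i j y ⊆ Ico 0 C) {u : ℝ≥0} (hu : 0 < u)
    (h : ν ({u} ×ˢ hitSet lam (Function.leftLim x u) (Function.leftLim y u)) = 0) :
    x u = Function.leftLim x u := by
  obtain ⟨s, hsu, hnull, hx, -⟩ := hs.exists_before hC hu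
  rw [← hx]
  refine (hs.eq_of_hits_null hsu.le (measure_mono_null ?_ (measure_union_null hnull h))).1
  rintro ⟨v, z⟩ hp
  rcases eq_or_lt_of_le hp.1.1.2 with rfl | hvu
  · exact Or.inr ⟨rfl, hp.2.2⟩
  · exact Or.inl (hs.hits_subset hC _ ⟨⟨⟨hp.1.1.1, hvu⟩, mem_univ _⟩, hp.2⟩)

lemma measure_rateInterval (hs : PathSolution lam C ν x y)
    (hC : ∀ i j, i ≠ j → ∀ y, 0 < y → rateInterval lam i j y ⊆ Ico 0 C) {u : ℝ≥0} (hu : 0 < u)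
    {i j : Fin k} (hij : j ≠ i) (h : ν ({u} ×ˢ rateInterval lam i j (Function.leftLim y u)) ≠ 0) :
    ν ({u} ×ˢ rateInterval lam i j (Function.leftLim y u)) = 1 := by
  refine le_antisymm ((measure_mono (Set.prod_mono_right
    (hC _ _ hij.symm _ (hs.leftLim_pos hC hu)))).trans (hs.simple u hu)) ?_
  by_contra hlt
  exact h (hs.measure_eq_zero ((measurableSet_singleton u).prod measurableSet_Ico)
    (not_le.1 hlt))

/-- On a short interval `(s, u]` the only hit is a single atom at time `u`, so the integrals reduce
to the values of `hFun` and `gFun` there: the label increases by `j - i`, and the whole age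
accumulated before `u` is subtracted. -/
lemma eq_of_measure_ne_zero (hs : PathSolution lam C ν x y) (hlam : IsRate lam)
    (hC : ∀ i j, i ≠ j → ∀ y, 0 < y → rateInterval lam i j y ⊆ Ico 0 C) {u : ℝ≥0} (hu : 0 < u)
    {j : Fin k} (hj : j ≠ Function.leftLim x u)
    (h : ν ({u} ×ˢ rateInterval lam (Function.leftLim x u) j (Function.leftLim y u)) ≠ 0) :
    x u = j ∧ y u = 0 := by
  obtain ⟨s, hsu, hnull, hx, hy⟩ := hs.exists_before hC hu
  have hpos := hs.leftLim_pos hC hu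
  have h1 := hs.measure_rateInterval hC hu hj h
  set A := {u} ×ˢ rateInterval lam (Function.leftLim x u) j (Function.leftLim y u) with hA
  have hAm : MeasurableSet A := (measurableSet_singleton u).prod measurableSet_Ico
  have hAR : A ⊆ {u} ×ˢ Ico 0 C := prod_mono_right (hC _ _ hj.symm _ hpos)
  -- Simplicity in time: `A` already uses up the only point of the fibre over `u`.
  have hrest : ν ({u} ×ˢ Ico 0 C \ A) = 0 := by
    rw [measure_sdiff hAR hAm.nullMeasurableSet (by simp [h1]), h1, tsub_eq_zero_iff_le]
    exact hs.simple u hu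
  have hsub : A ⊆ Ioc s u ×ˢ univ := Set.prod_mono (by simpa using hsu) (subset_univ _)
  have hae : ∀ᵐ p ∂ν, p ∈ Ioc s u ×ˢ univ \ A →
      p.2 ∉ hitSet lam (Function.leftLim x p.1) (Function.leftLim y p.1) := by
    refine measure_mono_null (fun p hp => ?_) (measure_union_null hnull hrest)
    simp only [mem_compl_iff, mem_ofPred_eq, Classical.not_imp, not_not] at hp
    obtain ⟨⟨hp1, hp2⟩, hp3⟩ := hp
    have hR := hs.hits_subset hC (Ioc s u) ⟨hp1, (zero_le).trans_lt hp1.1.1, hp3⟩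
    rcases eq_or_lt_of_le hp1.1.2 with he | hlt
    · exact Or.inr ⟨⟨he, hR.2⟩, hp2⟩
    · exact Or.inl ⟨⟨hp1.1.1, hlt⟩, hR.2⟩
  have hr1 : ν.real A = 1 := by simp [measureReal_def, h1]
  constructor
  · apply label_injective
    rw [hs.label_eq_add hsu.le, hx, setIntegral_eq_of_subset_of_ae_sdiff_eq_zero
      (measurableSet_Ioc.prod .univ).nullMeasurableSet hsub
      (hae.mono fun p hp hpA => hFun_eq_zero (hp hpA)),
      setIntegral_congr_fun (g := fun _ => label j - label (Function.leftLim x u)) hAm,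
      setIntegral_const, hr1, one_smul]
    · ring
    · rintro ⟨v, z⟩ ⟨rfl, hz⟩
      exact hFun_of_mem hlam hj hpos hz
  · rw [hs.age_eq_add hsu.le, hy, setIntegral_eq_of_subset_of_ae_sdiff_eq_zero
      (measurableSet_Ioc.prod .univ).nullMeasurableSet hsub
      (hae.mono fun p hp hpA => gFun_eq_zero (hp hpA)),
      setIntegral_congr_fun (g := fun _ => Function.leftLim y u) hAm,
      setIntegral_const, hr1, one_smul]
    · ring
    · rintro ⟨v, z⟩ ⟨rfl, hz⟩
      exact gFun_of_mem hlam hj hpos hz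

lemma exists_measure_ne_zero (hs : PathSolution lam C ν x y)
    (hC : ∀ i j, i ≠ j → ∀ y, 0 < y → rateInterval lam i j y ⊆ Ico 0 C) {u : ℝ≥0}
    (h : u ∈ transitionSet x) : ∃ j, j ≠ Function.leftLim x u ∧
      ν ({u} ×ˢ rateInterval lam (Function.leftLim x u) j (Function.leftLim y u)) ≠ 0 := by
  by_contra! hcon
  refine h.2 (hs.eq_leftLim_of_null hC h.1 ?_)
  rw [hitSet, prod_iUnion₂]
  exact (measure_biUnion_null_iff (to_countable _)).2 hcon

lemma mem_transitionSet_of_ne_zero (hs : PathSolution lam C ν x y) (hlam : IsRate lam)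
    (hC : ∀ i j, i ≠ j → ∀ y, 0 < y → rateInterval lam i j y ⊆ Ico 0 C) {u : ℝ≥0} (hu : 0 < u)
    (h : ν ({u} ×ˢ hitSet lam (Function.leftLim x u) (Function.leftLim y u)) ≠ 0) :
    u ∈ transitionSet x := by
  rw [hitSet, prod_iUnion₂, Ne, measure_biUnion_null_iff (to_countable _)] at h
  push Not at h
  obtain ⟨j, hj, h⟩ := h
  refine ⟨hu, ?_⟩
  rw [(hs.eq_of_measure_ne_zero hlam hC hu hj h).1]
  exact hj

lemma age_eq_zero (hs : PathSolution lam C ν x y) (hlam : IsRate lam)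
    (hC : ∀ i j, i ≠ j → ∀ y, 0 < y → rateInterval lam i j y ⊆ Ico 0 C) {u : ℝ≥0}
    (h : u ∈ transitionSet x) : y u = 0 := by
  obtain ⟨j, hj, h'⟩ := hs.exists_measure_ne_zero hC h
  exact (hs.eq_of_measure_ne_zero hlam hC h.1 hj h').2

lemma measure_strip_ne_zero (hs : PathSolution lam C ν x y)
    (hC : ∀ i j, i ≠ j → ∀ y, 0 < y → rateInterval lam i j y ⊆ Ico 0 C) {u : ℝ≥0}
    (h : u ∈ transitionSet x) : 1 ≤ ν ({u} ×ˢ Ico 0 C) := by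
  by_contra hlt
  have h0 := hs.measure_eq_zero ((measurableSet_singleton u).prod measurableSet_Ico)
    (not_le.1 hlt)
  obtain ⟨j, hj, h'⟩ := hs.exists_measure_ne_zero hC h
  exact h' (measure_mono_null (Set.prod_mono_right (hC _ _ hj.symm _ (hs.leftLim_pos hC h.1))) h0)

/-- Each transition costs mass at least one on its own fibre, and the fibres are disjoint in a strip
of finite mass. -/
lemma finite_transitionSet (hs : PathSolution lam C ν x y)
    (hC : ∀ i j, i ≠ j → ∀ y, 0 < y → rateInterval lam i j y ⊆ Ico 0 C) (t : ℝ≥0) :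
    (transitionSet x ∩ Iic t).Finite := by
  have hfin := Measure.finite_const_le_meas_of_disjoint_iUnion ν (ε := 1) one_pos
    (As := fun u : Ioc (0 : ℝ≥0) t => {(u : ℝ≥0)} ×ˢ Ico (0 : ℝ) C)
    (fun u => (measurableSet_singleton _).prod measurableSet_Ico)
    (fun u v huv => Disjoint.set_prod_left (by simpa using fun h => huv (Subtype.ext h)) _ _)
    ((measure_mono (iUnion_subset fun u =>
      Set.prod_mono_left (singleton_subset_iff.2 u.2))).trans_lt (hs.finite_strip t).lt_top).ne
  refine (hfin.image Subtype.val).subset fun u hu => ?_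
  exact ⟨⟨u, hu.1.1, hu.2⟩, hs.measure_strip_ne_zero hC hu.1, rfl⟩

/-- Each point has a neighbourhood in which the hits split into a left part, a right part and its
own fibre, all null; a locally null set is null. No measurability of `I` or of the hits is required.
-/
lemma hits_null (hs : PathSolution lam C ν x y) (hlam : IsRate lam)
    (hC : ∀ i j, i ≠ j → ∀ y, 0 < y → rateInterval lam i j y ⊆ Ico 0 C) {I : Set ℝ≥0}
    (hI : ∀ u ∈ I, u ∉ transitionSet x) : ν (I ×ˢ univ ∩ hits lam x y) = 0 := by
  refine measure_null_of_locally_null _ fun p hp => ?_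
  obtain ⟨a, ha, hanull⟩ := hs.exists_left_null hp.2.1
  obtain ⟨b, hb, hbnull⟩ := hs.exists_right_null p.1
  have hpnull : ν ({p.1} ×ˢ hitSet lam (Function.leftLim x p.1) (Function.leftLim y p.1)) = 0 := by
    by_contra h
    exact hI _ hp.1.1 (hs.mem_transitionSet_of_ne_zero hlam hC hp.2.1 h)
  refine ⟨I ×ˢ univ ∩ hits lam x y ∩ Ioo a b ×ˢ univ, inter_mem self_mem_nhdsWithin
    (mem_nhdsWithin_of_mem_nhds (prod_mem_nhds (Ioo_mem_nhds ha hb) univ_mem)), ?_⟩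
  refine measure_mono_null ?_ (measure_union_null (measure_union_null hanull hbnull) hpnull)
  rintro ⟨v, z⟩ ⟨hq, hv⟩
  have hz := (hs.hits_subset hC _ hq).2
  rcases lt_trichotomy v p.1 with hlt | rfl | hgt
  · exact Or.inl (Or.inl ⟨⟨hv.1.1, hlt⟩, hz⟩)
  · exact Or.inr ⟨rfl, hq.2.2⟩
  · exact Or.inl (Or.inr ⟨⟨hgt, hv.1.2⟩, hz⟩)

lemma eq_of_no_transition (hs : PathSolution lam C ν x y) (hlam : IsRate lam)
    (hC : ∀ i j, i ≠ j → ∀ y, 0 < y → rateInterval lam i j y ⊆ Ico 0 C) {s t : ℝ≥0} (hst : s ≤ t)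
    (h : ∀ u ∈ Ioc s t, u ∉ transitionSet x) : x t = x s ∧ y t = y s + (t - s : ℝ) :=
  hs.eq_of_hits_null hst (hs.hits_null hlam hC h)

lemma leftLim_of_no_transition (hs : PathSolution lam C ν x y) (hlam : IsRate lam)
    (hC : ∀ i j, i ≠ j → ∀ y, 0 < y → rateInterval lam i j y ⊆ Ico 0 C) {s t : ℝ≥0} (hst : s < t)
    (h : ∀ u ∈ Ioo s t, u ∉ transitionSet x) :
    Function.leftLim x t = x s ∧ Function.leftLim y t = y s + (t - s : ℝ) :=
  leftLim_eq hst fun _ hv => hs.eq_of_no_transition hlam hC hv.1.le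
    fun u hu => h u ⟨hu.1, hu.2.trans_lt hv.2⟩

/-- Local finiteness makes the infimum a minimum. -/
lemma sInf_transition (hs : PathSolution lam C ν x y)
    (hC : ∀ i j, i ≠ j → ∀ y, 0 < y → rateInterval lam i j y ⊆ Ico 0 C) {τ : ℝ≥0}
    (hne : ∃ t, t ∈ transitionSet x ∧ τ < t) :
    sInf {t | t ∈ transitionSet x ∧ τ < t} ∈ transitionSet x ∧
      τ < sInf {t | t ∈ transitionSet x ∧ τ < t} ∧
      ∀ u ∈ Ioo τ (sInf {t | t ∈ transitionSet x ∧ τ < t}), u ∉ transitionSet x := by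
  set A := {t | t ∈ transitionSet x ∧ τ < t} with hA
  have hlow : ∀ u ∈ Ioo τ (sInf A), u ∉ transitionSet x := fun u hu hu' =>
    (csInf_le' (show u ∈ A from ⟨hu', hu.1⟩)).not_gt hu.2
  have hmem : sInf A ∈ A := by
    obtain ⟨t, ht⟩ := hne
    have hfin : (A ∩ Iic t).Finite := (hs.finite_transitionSet hC t).subset
      fun u hu => ⟨hu.1.1, hu.2⟩
    have hne' : (A ∩ Iic t).Nonempty := ⟨t, ht, mem_Iic.2 le_rfl⟩
    have h := hne'.csInf_mem hfin
    have heq : sInf A = sInf (A ∩ Iic t) := by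
      refine le_antisymm (csInf_le' h.1) (le_csInf ⟨t, ht⟩ fun u hu => ?_)
      rcases le_total u t with hut | hut
      · exact csInf_le' ⟨hu, hut⟩
      · exact (csInf_le' ⟨ht, mem_Iic.2 le_rfl⟩ : sInf (A ∩ Iic t) ≤ t).trans hut
    rw [heq]
    exact h.1
  exact ⟨hmem.1, hmem.2, hlow⟩

/-- The points of `ν` with mark in `Λ_ij` that belong to the first transition after `τ`, the state
at time `τ` being `i` and the age before the transition being in `B`. -/
def nextHits (lam : Fin k → Fin k → ℝ → ℝ) (x : ℝ≥0 → Fin k) (y : ℝ≥0 → ℝ) (τ : ℝ≥0)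
    (i j : Fin k) (B : Set ℝ) : Set (ℝ≥0 × ℝ) :=
  {p | τ < p.1 ∧ (∀ v ∈ Ioo τ p.1, v ∉ transitionSet x) ∧ x τ = i ∧ Function.leftLim y p.1 ∈ B ∧
    p.2 ∈ rateInterval lam i j (Function.leftLim y p.1)}

lemma nextHits_subset_hits (hs : PathSolution lam C ν x y) (hlam : IsRate lam)
    (hC : ∀ i j, i ≠ j → ∀ y, 0 < y → rateInterval lam i j y ⊆ Ico 0 C) {τ : ℝ≥0}
    {i j : Fin k} (hij : i ≠ j) {B : Set ℝ} : nextHits lam x y τ i j B ⊆ hits lam x y := by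
  intro p hp
  refine ⟨(zero_le).trans_lt hp.1, mem_hitSet.2 ⟨j, ?_, ?_⟩⟩ <;>
    rw [(hs.leftLim_of_no_transition hlam hC hp.1 hp.2.1).1, hp.2.2.1]
  exacts [hij.symm, hp.2.2.2.2]

lemma measure_nextHits_of_none (hs : PathSolution lam C ν x y) (hlam : IsRate lam)
    (hC : ∀ i j, i ≠ j → ∀ y, 0 < y → rateInterval lam i j y ⊆ Ico 0 C) {τ : ℝ≥0}
    (h : ∀ t ∈ Ioi τ, t ∉ transitionSet x) {i j : Fin k} (hij : i ≠ j) {B : Set ℝ} :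
    ν (nextHits lam x y τ i j B) = 0 :=
  measure_mono_null (t := Ioi τ ×ˢ univ ∩ hits lam x y)
    (fun _ hp => ⟨⟨hp.1, mem_univ _⟩, hs.nextHits_subset_hits hlam hC hij hp⟩)
    (hs.hits_null hlam hC (I := Ioi τ) h)

-- Hits strictly between `τ` and `σ` are null, so only the fibre over `σ` counts. It carries mass in
-- `Λ_ij` exactly when the transition leads to `j`, and then that mass is one.
open Classical in
lemma measure_nextHits (hs : PathSolution lam C ν x y) (hlam : IsRate lam)
    (hC : ∀ i j, i ≠ j → ∀ y, 0 < y → rateInterval lam i j y ⊆ Ico 0 C) {τ σ : ℝ≥0}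
    (hτσ : τ < σ) (hσ : σ ∈ transitionSet x) (h : ∀ t ∈ Ioo τ σ, t ∉ transitionSet x)
    {i j : Fin k} (hij : i ≠ j) {B : Set ℝ} :
    ν (nextHits lam x y τ i j B) =
      if x τ = i ∧ x σ = j ∧ Function.leftLim y σ ∈ B then 1 else 0 := by
  have hleft := hs.leftLim_of_no_transition hlam hC hτσ h
  have hle : ∀ p ∈ nextHits lam x y τ i j B, p.1 ≤ σ := fun p hp => by
    by_contra hlt
    exact hp.2.1 σ ⟨hτσ, not_le.1 hlt⟩ hσ
  have hnull : ν (Ioo τ σ ×ˢ univ ∩ hits lam x y) = 0 := hs.hits_null hlam hC h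
  have hsub : nextHits lam x y τ i j B ⊆ Ioo τ σ ×ˢ univ ∩ hits lam x y ∪
      {σ} ×ˢ rateInterval lam i j (Function.leftLim y σ) := by
    rintro ⟨v, z⟩ hp
    rcases eq_or_lt_of_le (hle _ hp) with he | hlt
    · obtain rfl : v = σ := he
      exact Or.inr ⟨rfl, hp.2.2.2.2⟩
    · exact Or.inl ⟨⟨⟨hp.1, hlt⟩, mem_univ _⟩, hs.nextHits_subset_hits hlam hC hij hp⟩
  split_ifs with hc
  · obtain ⟨hi, hj, hB⟩ := hc
    obtain ⟨l, hl, hne⟩ := hs.exists_measure_ne_zero hC hσ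
    obtain rfl : l = j := (hs.eq_of_measure_ne_zero hlam hC hσ.1 hl hne).1.symm.trans hj
    rw [hleft.1, hi] at hne
    rw [← hs.measure_rateInterval hC hσ.1 hij.symm hne]
    refine le_antisymm ?_ (measure_mono ?_)
    · refine (measure_mono hsub).trans ((measure_union_le _ _).trans ?_)
      rw [hnull, zero_add]
    · rintro ⟨v, z⟩ ⟨rfl, hz⟩
      exact ⟨hτσ, h, hi, hB, hz⟩
  · by_cases hiB : x τ = i ∧ Function.leftLim y σ ∈ B
    -- Here only the target state can be wrong; mass in `Λ_ij` over `σ` would force it to be `j`.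
    · refine measure_mono_null hsub (measure_union_null hnull ?_)
      by_contra hne
      rw [← hiB.1, ← hleft.1] at hne
      refine hc ⟨hiB.1, (hs.eq_of_measure_ne_zero hlam hC hσ.1 ?_ hne).1, hiB.2⟩
      rw [hleft.1, hiB.1]
      exact hij.symm
    · refine measure_mono_null ?_ hnull
      rintro ⟨v, z⟩ hp
      refine ⟨⟨⟨hp.1, (hle _ hp).lt_of_ne ?_⟩, mem_univ _⟩, hs.nextHits_subset_hits hlam hC hij hp⟩
      rintro rfl
      exact hiB ⟨hp.2.2.1, hp.2.2.2.1⟩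

end PathSolution

/-! ### Poisson random measures -/

lemma measurableEmbedding_coe_prod :
    MeasurableEmbedding (fun p : ℝ≥0 × ℝ => ((p.1 : ℝ), p.2)) :=
  (MeasurableEmbedding.subtype_coe measurableSet_Ici).prodMap MeasurableEmbedding.id

/-- Lebesgue measure on `ℝ₊`. -/
def volumeNNReal : Measure ℝ≥0 := (volume : Measure ℝ).comap (fun u : ℝ≥0 => (u : ℝ))

lemma volumeNNReal_apply (s : Set ℝ≥0) : volumeNNReal s = volume ((↑) '' s : Set ℝ) :=
  (MeasurableEmbedding.subtype_coe measurableSet_Ici).comap_apply volume s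

lemma intensity_prod (s : Set ℝ≥0) (t : Set ℝ) : intensity (s ×ˢ t) = volumeNNReal s * volume t := by
  rw [intensity, measurableEmbedding_coe_prod.comap_apply, volumeNNReal_apply,
    ← Measure.prod_prod, Measure.volume_eq_prod]
  congr 1
  ext ⟨a, b⟩
  simp only [mem_image, mem_prod, Prod.mk.injEq, Prod.exists]
  constructor
  · rintro ⟨u, z, ⟨hu, hz⟩, rfl, rfl⟩
    exact ⟨⟨u, hu, rfl⟩, hz⟩
  · rintro ⟨⟨u, hu, rfl⟩, hz⟩
    exact ⟨u, b, ⟨hu, hz⟩, rfl, rfl⟩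

lemma volumeNNReal_Ioc (s t : ℝ≥0) : volumeNNReal (Ioc s t) = ENNReal.ofReal (t - s) := by
  rw [volumeNNReal_apply, ← Real.volume_Ioc]
  congr 1
  ext a
  constructor
  · rintro ⟨u, hu, rfl⟩
    exact ⟨by exact_mod_cast hu.1, by exact_mod_cast hu.2⟩
  · intro ha
    exact ⟨⟨a, s.2.trans ha.1.le⟩, ⟨ha.1, ha.2⟩, rfl⟩

lemma intensity_strip (s t : ℝ≥0) (C : ℝ) :
    intensity (Ioc s t ×ˢ Ico 0 C) = ENNReal.ofReal (t - s) * ENNReal.ofReal C := by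
  rw [intensity_prod, volumeNNReal_Ioc, Real.volume_Ico, sub_zero]

instance : SigmaFinite volumeNNReal := by
  refine ⟨⟨⟨fun n : ℕ => Iic (n : ℝ≥0), fun _ => trivial, fun n => ?_, ?_⟩⟩⟩
  · rw [volumeNNReal_apply]
    refine (measure_mono (t := Icc (0 : ℝ) n) ?_).trans_lt (by simp)
    rintro _ ⟨u, hu, rfl⟩
    exact ⟨u.2, by exact_mod_cast mem_Iic.1 hu⟩
  · exact eq_univ_of_forall fun u => mem_iUnion.2 (exists_nat_ge u)

lemma intensity_eq_prod : intensity = volumeNNReal.prod (volume : Measure ℝ) :=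
  (Measure.prod_eq fun s t _ _ => intensity_prod s t).symm

lemma hasSum_mul_poisson (r : ℝ≥0) :
    HasSum (fun n : ℕ => (n : ℝ) * (Real.exp (-r) * r ^ n / (n.factorial : ℝ))) r := by
  rw [← hasSum_nat_add_iff' 1]
  have h := (hasSum_one_poissonMeasure r).mul_left (r : ℝ)
  simp only [mul_one] at h
  simp only [Finset.range_one, Finset.sum_singleton, Nat.cast_zero, zero_mul, sub_zero]
  refine h.congr_fun fun n => ?_
  rw [Nat.factorial_succ]
  push_cast
  have : (n : ℝ) + 1 ≠ 0 := by positivity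
  field_simp
  ring

section

variable {Ω E : Type*} [MeasurableSpace Ω] [MeasurableSpace E] {N : Ω → Measure E}
  {μ : Measure E} {P : Measure Ω}

namespace IsPoissonRandomMeasure

lemma measurable_apply (hN : IsPoissonRandomMeasure N μ P) {A : Set E} (hA : MeasurableSet A) :
    Measurable fun ω => N ω A :=
  (Measure.measurable_coe hA).comp hN.measurable

/-- The mean number of points of a Poisson random measure in a set of finite mean measure. -/
lemma lintegral_apply (hN : IsPoissonRandomMeasure N μ P) [IsProbabilityMeasure P] {A : Set E}
    (hA : MeasurableSet A) (hμA : μ A ≠ ∞) : ∫⁻ ω, N ω A ∂P = μ A := by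
  set S : ℕ → Set Ω := fun n => {ω | N ω A = n} with hS
  have hSm : ∀ n, MeasurableSet (S n) := fun n => hN.measurable_apply hA (measurableSet_singleton _)
  have hdisj : Pairwise (Function.onFun Disjoint S) := fun m n hmn =>
    Set.disjoint_left.2 fun ω hm hn => hmn (by
      have : (m : ℝ≥0∞) = n := hm.symm.trans hn
      exact_mod_cast this)
  have hPS : ∀ n, P (S n) = ENNReal.ofReal (Real.exp (-(μ A).toNNReal) * (μ A).toNNReal ^ n /
      (n.factorial : ℝ)) := hN.count_of_finite A hA hμA
  have hone : P (⋃ n, S n) = 1 := by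
    rw [measure_iUnion hdisj hSm]
    simp_rw [hPS]
    rw [← ENNReal.ofReal_tsum_of_nonneg (fun n => by positivity)
      (hasSum_one_poissonMeasure _).summable, (hasSum_one_poissonMeasure _).tsum_eq,
      ENNReal.ofReal_one]
  -- The Poisson weights sum to one, so the count is almost surely finite.
  have hae : (univ : Set Ω) =ᵐ[P] ⋃ n, S n :=
    (ae_eq_univ.2 ((prob_compl_eq_zero_iff (MeasurableSet.iUnion hSm)).2 hone)).symm
  rw [← setLIntegral_univ, setLIntegral_congr hae, lintegral_iUnion hSm hdisj]
  have hterm : ∀ n, ∫⁻ ω in S n, N ω A ∂P = ENNReal.ofReal ((n : ℝ) *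
      (Real.exp (-(μ A).toNNReal) * (μ A).toNNReal ^ n / (n.factorial : ℝ))) := fun n => by
    rw [setLIntegral_congr_fun (hSm n) (g := fun _ => (n : ℝ≥0∞)) (fun ω hω => hω),
      setLIntegral_const, hPS, ENNReal.ofReal_mul (by positivity), ENNReal.ofReal_natCast]
  simp_rw [hterm]
  rw [← ENNReal.ofReal_tsum_of_nonneg (fun n => by positivity)
      (hasSum_mul_poisson _).summable, (hasSum_mul_poisson _).tsum_eq, ENNReal.ofReal_coe_nnreal,
      ENNReal.coe_toNNReal hμA]

lemma ae_lt_top (hN : IsPoissonRandomMeasure N μ P) [IsProbabilityMeasure P] {A : Set E}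
    (hA : MeasurableSet A) (hμA : μ A ≠ ∞) : ∀ᵐ ω ∂P, N ω A < ∞ :=
  MeasureTheory.ae_lt_top (hN.measurable_apply hA) (by rwa [hN.lintegral_apply hA hμA])

/-- With `a` the mean, the probability is `1 - exp(-a)(1 + a)`, and `exp(-a) ≥ 1 - a` bounds this by
`1 - (1 - a)(1 + a) = a²`. -/
lemma measure_one_lt_le (hN : IsPoissonRandomMeasure N μ P) [IsProbabilityMeasure P] {A : Set E}
    (hA : MeasurableSet A) (hμA : μ A ≠ ∞) : P {ω | 1 < N ω A} ≤ μ A ^ 2 := by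
  have h0 := hN.count_of_finite A hA hμA 0
  have h1 := hN.count_of_finite A hA hμA 1
  set a := (μ A).toReal with ha
  have ha0 : 0 ≤ a := ENNReal.toReal_nonneg
  have hm : ∀ n : ℕ, MeasurableSet {ω | N ω A = n} :=
    fun n => hN.measurable_apply hA (measurableSet_singleton _)
  have hsub : {ω | 1 < N ω A} ⊆ ({ω | N ω A = (0 : ℕ)} ∪ {ω | N ω A = (1 : ℕ)})ᶜ := by
    rintro ω hω (h | h) <;> simp only [mem_ofPred_eq] at h hω <;> simp [h] at hω
  have hdisj : Disjoint {ω | N ω A = (0 : ℕ)} {ω | N ω A = (1 : ℕ)} :=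
    Set.disjoint_left.2 fun ω hm hn => by
      simp only [mem_ofPred_eq] at hm hn
      simp [hm] at hn
  refine (measure_mono hsub).trans ?_
  rw [prob_compl_eq_one_sub ((hm 0).union (hm 1)), measure_union hdisj (hm 1), h0, h1,
    ← ENNReal.ofReal_add (by positivity) (by positivity), ← ENNReal.ofReal_toReal hμA, ← ha,
    ← ENNReal.ofReal_pow ha0, ← ENNReal.ofReal_one, ← ENNReal.ofReal_sub _ (by positivity)]
  refine ENNReal.ofReal_le_ofReal ?_
  have hexp : 1 - a ≤ Real.exp (-a) := by linarith [Real.add_one_le_exp (-a)]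
  simp only [pow_zero, mul_one, Nat.factorial_zero, Nat.cast_one, div_one, pow_one,
    Nat.factorial_one]
  nlinarith

end IsPoissonRandomMeasure

end

section

variable {Ω : Type*} [MeasurableSpace Ω] {N : Ω → Measure (ℝ≥0 × ℝ)} {P : Measure Ω}
  [IsProbabilityMeasure P]

lemma ae_finite_strip (hN : IsPoissonRandomMeasure N intensity P) (C : ℝ) :
    ∀ᵐ ω ∂P, ∀ t, N ω (Ioc 0 t ×ˢ Ico 0 C) ≠ ∞ := by
  have h : ∀ᵐ ω ∂P, ∀ n : ℕ, N ω (Ioc 0 (n : ℝ≥0) ×ˢ Ico 0 C) < ∞ :=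
    ae_all_iff.2 fun n => hN.ae_lt_top (measurableSet_Ioc.prod measurableSet_Ico) (by
      rw [intensity_strip]
      finiteness)
  filter_upwards [h] with ω hω t
  obtain ⟨n, hn⟩ := exists_nat_ge t
  exact ((measure_mono (Set.prod_mono_left (Ioc_subset_Ioc_right hn))).trans_lt (hω n)).ne

/-- Cut `(0, M]` into `M(m+1)` cells of length `1/(m+1)`. Two points at one time put two points in
one cell, which has probability at most `(C/(m+1))²` per cell. The union bound `M C²/(m+1)` tends to
`0`; outer measure suffices for the bad set. -/
lemma ae_simple (hN : IsPoissonRandomMeasure N intensity P) {C : ℝ} (hC : 0 ≤ C) :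
    ∀ᵐ ω ∂P, ∀ u, 0 < u → N ω ({u} ×ˢ Ico 0 C) ≤ 1 := by
  have key : ∀ M : ℕ, ∀ᵐ ω ∂P, ∀ u : ℝ≥0, 0 < u → u ≤ M → N ω ({u} ×ˢ Ico 0 C) ≤ 1 := by
    intro M
    set bad : Set Ω := {ω | ∀ u : ℝ≥0, 0 < u → u ≤ M → N ω ({u} ×ˢ Ico 0 C) ≤ 1}ᶜ with hbad
    have hbound : ∀ m : ℕ, P bad ≤ ENNReal.ofReal ((M * C ^ 2) * (1 / ((m : ℝ) + 1))) := by
      intro m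
      set I : ℕ → Set (ℝ≥0 × ℝ) := fun l =>
        Ioc ((l : ℝ≥0) / (m + 1)) (((l : ℝ≥0) + 1) / (m + 1)) ×ˢ Ico 0 C with hI
      have hIm : ∀ l, MeasurableSet (I l) := fun l => measurableSet_Ioc.prod measurableSet_Ico
      have hIi : ∀ l, intensity (I l) = ENNReal.ofReal (C / (m + 1)) := fun l => by
        rw [hI, intensity_strip, ← ENNReal.ofReal_mul]
        · congr 1
          push_cast
          ring
        · push_cast
          rw [sub_nonneg]
          gcongr
          linarith
      have hsub : bad ⊆ ⋃ l ∈ Finset.range (M * (m + 1)), {ω | 1 < N ω (I l)} := by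
        intro ω hω
        simp only [hbad, mem_compl_iff, mem_ofPred_eq, not_forall, not_le] at hω
        obtain ⟨u, hu, huM, h1⟩ := hω
        -- The cells are left-open, so the one containing `u` has index `⌈u(m+1)⌉ - 1`.
        have hpos : 0 < ⌈u * (m + 1)⌉₊ := Nat.ceil_pos.2 (by positivity)
        obtain ⟨l, hl⟩ := Nat.exists_eq_succ_of_ne_zero hpos.ne'
        have hle : u * (m + 1) ≤ (l : ℝ≥0) + 1 := by
          have := Nat.le_ceil (u * ((m : ℝ≥0) + 1))
          rw [hl] at this
          exact_mod_cast this
        have hlt : (l : ℝ≥0) < u * (m + 1) := Nat.lt_ceil.1 (by omega)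
        have hm0 : (0 : ℝ≥0) < m + 1 := by positivity
        have hlM : l < M * (m + 1) := by
          have : (l : ℝ≥0) < M * (m + 1) := hlt.trans_le (by gcongr)
          exact_mod_cast this
        refine mem_biUnion (Finset.mem_coe.2 (Finset.mem_range.2 hlM)) (h1.trans_le ?_)
        refine measure_mono (Set.prod_mono_left (singleton_subset_iff.2 ⟨?_, ?_⟩))
        · rwa [div_lt_iff₀ hm0]
        · rwa [le_div_iff₀ hm0]
      refine (measure_mono hsub).trans ((measure_biUnion_finset_le _ _).trans ?_)
      calc ∑ l ∈ Finset.range (M * (m + 1)), P {ω | 1 < N ω (I l)}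
          ≤ ∑ l ∈ Finset.range (M * (m + 1)), ENNReal.ofReal (C / (m + 1)) ^ 2 :=
            Finset.sum_le_sum fun l _ => (hN.measure_one_lt_le (hIm l) (by rw [hIi]; finiteness)).trans
              (by rw [hIi])
        _ = ENNReal.ofReal ((M * C ^ 2) * (1 / ((m : ℝ) + 1))) := by
          rw [Finset.sum_const, Finset.card_range, nsmul_eq_mul, ← ENNReal.ofReal_natCast,
            ← ENNReal.ofReal_pow (by positivity), ← ENNReal.ofReal_mul (by positivity)]
          congr 1
          push_cast
          field_simp
    have hlim : Tendsto (fun m : ℕ => ENNReal.ofReal ((M * C ^ 2) * (1 / ((m : ℝ) + 1))))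
        atTop (𝓝 0) := by
      have := (tendsto_one_div_add_atTop_nhds_zero_nat (𝕜 := ℝ)).const_mul (M * C ^ 2)
      rw [mul_zero] at this
      simpa using ENNReal.tendsto_ofReal this
    exact le_antisymm (ge_of_tendsto' hlim hbound) (zero_le)
  filter_upwards [ae_all_iff.2 key] with ω hω u hu
  obtain ⟨n, hn⟩ := exists_nat_ge u
  exact hω n u hu hn

lemma ae_pathSolution {ℱ : Filtration ℝ≥0 ‹MeasurableSpace Ω›} {k : ℕ} {lam : Fin k → Fin k → ℝ → ℝ}
    {X : ℝ≥0 → Ω → Fin k} {Y : ℝ≥0 → Ω → ℝ} (hN : IsPoissonRelTo N ℱ P)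
    (hXY : IsStrongSolution lam N ℱ P X Y) {C : ℝ} (hC : 0 ≤ C) :
    ∀ᵐ ω ∂P, PathSolution lam C (N ω) (fun t => X t ω) (fun t => Y t ω) := by
  filter_upwards [ae_finite_strip hN.poisson C, ae_simple hN.poisson hC, hXY.nonneg_Y,
    hXY.cadlag_X, hXY.cadlag_Y, hXY.eq_X, hXY.eq_Y] with ω h1 h2 h3 h4 h5 h6 h7
  exact ⟨hN.poisson.integer_valued ω, h1, h2, h3, h4, h5, h6, h7⟩

end

/-! ### The compensation formula -/

section

variable {Ω : Type*} [mΩ : MeasurableSpace Ω]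

/-- The rectangles `F × (s, ∞) × B` with `F ∈ ℱ_s`. -/
def predictableRect (ℱ : Filtration ℝ≥0 mΩ) : Set (Set (Ω × ℝ≥0 × ℝ)) :=
  {S | ∃ (s : ℝ≥0) (F : Set Ω) (B : Set ℝ), MeasurableSet[ℱ s] F ∧ MeasurableSet B ∧
    S = F ×ˢ (Ioi s ×ˢ B)}

/-- The predictable σ-algebra for marked processes, on strictly positive times. -/
@[reducible]
def predictable (ℱ : Filtration ℝ≥0 mΩ) : MeasurableSpace (Ω × ℝ≥0 × ℝ) :=
  MeasurableSpace.generateFrom (predictableRect ℱ)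

variable {ℱ : Filtration ℝ≥0 mΩ}

lemma isPiSystem_predictableRect : IsPiSystem (predictableRect ℱ) := by
  rintro _ ⟨s, F, B, hF, hB, rfl⟩ _ ⟨s', F', B', hF', hB', rfl⟩ -
  refine ⟨max s s', F ∩ F', B ∩ B', ?_, hB.inter hB', ?_⟩
  · exact (ℱ.mono (le_max_left _ _) _ hF).inter (ℱ.mono (le_max_right _ _) _ hF')
  · rw [prod_inter_prod, prod_inter_prod, Ioi_inter_Ioi]

lemma predictable_le : predictable ℱ ≤ (inferInstance : MeasurableSpace (Ω × ℝ≥0 × ℝ)) := by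
  refine MeasurableSpace.generateFrom_le ?_
  rintro _ ⟨s, F, B, hF, hB, rfl⟩
  exact (ℱ.le s _ hF).prod (measurableSet_Ioi.prod hB)

/-! ### Random measures as s-finite kernels -/

section Kernel

variable {E : Type*} [MeasurableSpace E] {N : Ω → Measure E} {I : Set E}

lemma measurableSet_count_eq (hN : Measurable N) (hI : MeasurableSet I) (n : ℕ) :
    MeasurableSet {ω | N ω I = n} :=
  (Measure.measurable_coe hI).comp hN (measurableSet_singleton _)

/-- A random measure, restricted to a set and to the event that it is a finite integer there. -/
def restrictKernel (hN : Measurable N) (hI : MeasurableSet I) : Kernel Ω E := by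
  classical
  exact Kernel.sum fun n : ℕ => Kernel.piecewise (s := {ω | N ω I = n})
    (measurableSet_count_eq hN hI n)
    ((⟨N, hN⟩ : Kernel Ω E).restrict hI) 0

/-- Splitting by the value of the count bounds the `n`-th piece by `n`, even if the random measure
itself has no uniform bound. S-finiteness gives access to measurability of sections and to `⊗ₘ`. -/
instance (hN : Measurable N) (hI : MeasurableSet I) : IsSFiniteKernel (restrictKernel hN hI) := by
  classical
  have h : ∀ n : ℕ, IsFiniteKernel (Kernel.piecewise (s := {ω | N ω I = n})
      (measurableSet_count_eq hN hI n)
      ((⟨N, hN⟩ : Kernel Ω E).restrict hI) 0) := fun n => by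
    refine ⟨n, ENNReal.natCast_lt_top n, fun ω => ?_⟩
    rw [Kernel.piecewise_apply]
    split_ifs with hω
    · rw [Kernel.restrict_apply, Measure.restrict_apply_univ]
      exact le_of_eq hω
    · simp
  unfold restrictKernel
  infer_instance

lemma restrictKernel_apply (hN : Measurable N) (hI : MeasurableSet I) {ω : Ω}
    (hω : ∃ n : ℕ, N ω I = n) {A : Set E} (hA : MeasurableSet A) :
    restrictKernel hN hI ω A = N ω (A ∩ I) := by
  classical
  obtain ⟨n, hn⟩ := hω
  rw [restrictKernel, Kernel.sum_apply' _ _ hA, tsum_eq_single n]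
  · rw [Kernel.piecewise_apply, if_pos (show ω ∈ {ω | N ω I = n} from hn),
      Kernel.restrict_apply, Measure.restrict_apply hA]
    rfl
  · intro m hm
    rw [Kernel.piecewise_apply, if_neg]
    · simp
    · intro h
      have : (m : ℝ≥0∞) = n := h.symm.trans hn
      exact hm (by exact_mod_cast this)

end Kernel

variable {N : Ω → Measure (ℝ≥0 × ℝ)} {P : Measure Ω} [IsProbabilityMeasure P]

lemma ae_restrictKernel_apply (hN : IsPoissonRandomMeasure N intensity P) {I : Set (ℝ≥0 × ℝ)}
    (hI : MeasurableSet I) (hIfin : intensity I ≠ ∞) :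
    ∀ᵐ ω ∂P, ∀ A, MeasurableSet A →
      restrictKernel hN.measurable hI ω A = N ω (A ∩ I) := by
  filter_upwards [hN.ae_lt_top hI hIfin] with ω hω A hA
  exact restrictKernel_apply _ _ ((hN.integer_valued ω I hI).resolve_left hω.ne) hA

lemma aemeasurable_section_inter (hN : IsPoissonRandomMeasure N intensity P)
    {I : Set (ℝ≥0 × ℝ)} (hI : MeasurableSet I) (hIfin : intensity I ≠ ∞)
    {S : Set (Ω × ℝ≥0 × ℝ)} (hS : MeasurableSet S) :
    AEMeasurable (fun ω => N ω (Prod.mk ω ⁻¹' S ∩ I)) P := by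
  refine (Kernel.measurable_kernel_prodMk_left (κ := restrictKernel hN.measurable hI)
    hS).aemeasurable.congr ?_
  filter_upwards [ae_restrictKernel_apply hN hI hIfin] with ω hω
  exact hω _ (measurable_prodMk_left hS)

lemma setLIntegral_apply (hN : IsPoissonRelTo N ℱ P) {s : ℝ≥0} {F : Set Ω}
    (hF : MeasurableSet[ℱ s] F) {A : Set (ℝ≥0 × ℝ)} (hA : MeasurableSet A)
    (hAs : A ⊆ Ioi s ×ˢ univ) (hfin : intensity A ≠ ∞) :
    ∫⁻ ω in F, N ω A ∂P = P F * intensity A := by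
  have hres : Measurable fun ω => (N ω).restrict (Ioi s ×ˢ (univ : Set ℝ)) :=
    Measure.measurable_of_measurable_coe _ fun B hB => by
      simp_rw [Measure.restrict_apply hB]
      exact hN.poisson.measurable_apply (hB.inter (measurableSet_Ioi.prod .univ))
  have hmeas : Measurable[MeasurableSpace.comap
      (fun ω => (N ω).restrict (Ioi s ×ˢ (univ : Set ℝ))) inferInstance] fun ω => N ω A := by
    have h := (Measure.measurable_coe hA).comp
      (comap_measurable (fun ω => (N ω).restrict (Ioi s ×ˢ (univ : Set ℝ))))
    convert h using 2 with ω
    simp only [Function.comp]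
    rw [Measure.restrict_apply hA, inter_eq_left.2 hAs]
  have h := lintegral_mul_eq_lintegral_mul_lintegral_of_independent_measurableSpace
    (ℱ.le s) hres.comap_le (hN.indep_future s)
    (Measurable.indicator (measurable_const (a := (1 : ℝ≥0∞))) hF) hmeas
  rw [lintegral_indicator (ℱ.le s _ hF), setLIntegral_const, one_mul,
    hN.poisson.lintegral_apply hA hfin] at h
  rw [← h, ← lintegral_indicator (ℱ.le s _ hF)]
  refine lintegral_congr fun ω => ?_
  by_cases hω : ω ∈ F <;> simp [hω]

/-- Both sides are finite measures of `S`. On a rectangle `F × (s, ∞) × B` they agree because the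
points after `s` are independent of `F ∈ ℱ_s`, and the rectangles form a π-system generating the
predictable σ-algebra. -/
lemma lintegral_section_strip (hN : IsPoissonRelTo N ℱ P) {a b : ℝ≥0} {C : ℝ}
    {S : Set (Ω × ℝ≥0 × ℝ)} (hS : MeasurableSet[predictable ℱ] S) :
    ∫⁻ ω, N ω (Prod.mk ω ⁻¹' S ∩ Ioc a b ×ˢ Ico 0 C) ∂P =
      ∫⁻ ω, intensity (Prod.mk ω ⁻¹' S ∩ Ioc a b ×ˢ Ico 0 C) ∂P := by
  set I : Set (ℝ≥0 × ℝ) := Ioc a b ×ˢ Ico 0 C with hIdef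
  have hI : MeasurableSet I := measurableSet_Ioc.prod measurableSet_Ico
  have hIfin : intensity I ≠ ∞ := by
    rw [hIdef, intensity_strip]
    finiteness
  have : IsFiniteMeasure (intensity.restrict I) := isFiniteMeasure_restrict.2 hIfin
  have h1 : ∀ S : Set (Ω × ℝ≥0 × ℝ), MeasurableSet S →
      (P ⊗ₘ restrictKernel hN.poisson.measurable hI) S =
        ∫⁻ ω, N ω (Prod.mk ω ⁻¹' S ∩ I) ∂P := fun S hS => by
    rw [Measure.compProd_apply hS]
    refine lintegral_congr_ae ?_
    filter_upwards [ae_restrictKernel_apply hN.poisson hI hIfin] with ω hω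
    exact hω _ (measurable_prodMk_left hS)
  have h2 : ∀ S : Set (Ω × ℝ≥0 × ℝ), MeasurableSet S →
      (P.prod (intensity.restrict I)) S = ∫⁻ ω, intensity (Prod.mk ω ⁻¹' S ∩ I) ∂P :=
    fun S hS => by
    rw [Measure.prod_apply hS]
    exact lintegral_congr fun ω => Measure.restrict_apply (measurable_prodMk_left hS)
  rw [← h1 S (predictable_le _ hS), ← h2 S (predictable_le _ hS)]
  have huniv : (P.prod (intensity.restrict I)) univ =
      (P ⊗ₘ restrictKernel hN.poisson.measurable hI) univ := by
    rw [h1 _ .univ, h2 _ .univ]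
    simp only [preimage_univ, univ_inter]
    rw [hN.poisson.lintegral_apply hI hIfin, lintegral_const, measure_univ, mul_one]
  refine (ext_on_measurableSpace_of_generate_finite _ (predictableRect ℱ) ?_ predictable_le rfl
    isPiSystem_predictableRect huniv hS).symm
  rintro _ ⟨s, F, B, hF, hB, rfl⟩
  have hm : MeasurableSet (F ×ˢ (Ioi s ×ˢ B)) := (ℱ.le s _ hF).prod (measurableSet_Ioi.prod hB)
  have hA : MeasurableSet (Ioi s ×ˢ B ∩ I) := (measurableSet_Ioi.prod hB).inter hI
  have hsec : ∀ ν : Ω → Measure (ℝ≥0 × ℝ),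
      ∫⁻ ω, ν ω (Prod.mk ω ⁻¹' (F ×ˢ (Ioi s ×ˢ B)) ∩ I) ∂P =
        ∫⁻ ω in F, ν ω (Ioi s ×ˢ B ∩ I) ∂P := fun ν => by
    rw [← lintegral_indicator (ℱ.le s _ hF)]
    refine lintegral_congr fun ω => ?_
    by_cases hω : ω ∈ F
    · simp [hω, mk_preimage_prod_right]
    · simp [hω, mk_preimage_prod_right_eq_empty]
  rw [h1 _ hm, h2 _ hm, hsec N, hsec fun _ => intensity, setLIntegral_const, mul_comm]
  exact (setLIntegral_apply hN hF hA (inter_subset_left.trans (Set.prod_mono_right (subset_univ _)))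
    ((measure_mono inter_subset_right).trans_lt hIfin.lt_top).ne).symm

lemma iUnion_strip (C : ℝ) : ⋃ n : ℕ, Ioc (n : ℝ≥0) (n + 1 : ℕ) ×ˢ Ico 0 C = Ioi 0 ×ˢ Ico 0 C := by
  rw [← iUnion_prod_const]
  congr 1
  ext u
  simp only [mem_iUnion, mem_Ioc, mem_Ioi]
  constructor
  · rintro ⟨n, hn, -⟩
    exact (zero_le).trans_lt hn
  · intro hu
    obtain ⟨n, hn⟩ := Nat.exists_eq_succ_of_ne_zero (Nat.ceil_pos.2 hu).ne'
    exact ⟨n, Nat.lt_ceil.1 (by omega), by rw [← Nat.succ_eq_add_one, ← hn]; exact Nat.le_ceil u⟩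

lemma measure_inter_strip (ν : Measure (ℝ≥0 × ℝ)) {A : Set (ℝ≥0 × ℝ)} (hA : MeasurableSet A)
    (C : ℝ) : ν (A ∩ Ioi 0 ×ˢ Ico 0 C) =
      ∑' n : ℕ, ν (A ∩ Ioc (n : ℝ≥0) (n + 1 : ℕ) ×ˢ Ico 0 C) := by
  rw [← iUnion_strip, inter_iUnion, measure_iUnion]
  · intro m n hmn
    refine Disjoint.mono inter_subset_right inter_subset_right (Disjoint.set_prod_left ?_ _ _)
    exact Nat.mono_cast.pairwise_disjoint_on_Ioc_succ hmn
  · exact fun n => hA.inter (measurableSet_Ioc.prod measurableSet_Ico)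

lemma intensity_strip_ne_top (s t : ℝ≥0) (C : ℝ) : intensity (Ioc s t ×ˢ Ico 0 C) ≠ ∞ := by
  rw [intensity_strip]
  finiteness

lemma aemeasurable_section (hN : IsPoissonRandomMeasure N intensity P) {C : ℝ}
    {S : Set (Ω × ℝ≥0 × ℝ)} (hS : MeasurableSet S) :
    AEMeasurable (fun ω => N ω (Prod.mk ω ⁻¹' S ∩ Ioi 0 ×ˢ Ico 0 C)) P := by
  simp_rw [measure_inter_strip _ (measurable_prodMk_left hS)]
  exact AEMeasurable.tsum fun n => aemeasurable_section_inter hN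
    (measurableSet_Ioc.prod measurableSet_Ico) (intensity_strip_ne_top _ _ _) hS

/-- The compensation formula for predictable sets with bounded marks. -/
lemma lintegral_section (hN : IsPoissonRelTo N ℱ P) {C : ℝ}
    {S : Set (Ω × ℝ≥0 × ℝ)} (hS : MeasurableSet[predictable ℱ] S) :
    ∫⁻ ω, N ω (Prod.mk ω ⁻¹' S ∩ Ioi 0 ×ˢ Ico 0 C) ∂P =
      ∫⁻ ω, intensity (Prod.mk ω ⁻¹' S ∩ Ioi 0 ×ˢ Ico 0 C) ∂P := by
  have hS' := predictable_le _ hS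
  have : SFinite intensity := by
    rw [intensity_eq_prod]
    infer_instance
  simp_rw [measure_inter_strip _ (measurable_prodMk_left hS')]
  rw [lintegral_tsum, lintegral_tsum]
  · exact tsum_congr fun n => lintegral_section_strip hN hS
  · intro n
    have hm : MeasurableSet (S ∩ univ ×ˢ (Ioc (n : ℝ≥0) (n + 1 : ℕ) ×ˢ Ico 0 C)) :=
      hS'.inter (MeasurableSet.univ.prod (measurableSet_Ioc.prod measurableSet_Ico))
    convert (measurable_measure_prodMk_left (ν := intensity) hm).aemeasurable using 3
    ext p
    simp
  · exact fun n => aemeasurable_section_inter hN.poisson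
      (measurableSet_Ioc.prod measurableSet_Ico) (intensity_strip_ne_top _ _ _) hS'

end

/-! ### The predictable set of the points of the next transition -/

/-- A dense sequence of times. -/
def gridTime (n : ℕ) : ℝ≥0 := TopologicalSpace.denseSeq ℝ≥0 n

lemma exists_gridTime_between {s t : ℝ≥0} (h : s < t) : ∃ n, s < gridTime n ∧ gridTime n < t := by
  obtain ⟨_, ⟨n, rfl⟩, hn⟩ := (TopologicalSpace.denseRange_denseSeq ℝ≥0).exists_between h
  exact ⟨n, hn⟩

section Predictable

variable {Ω : Type*} [mΩ : MeasurableSpace Ω] {ℱ : Filtration ℝ≥0 mΩ} {k : ℕ}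
  {lam : Fin k → Fin k → ℝ → ℝ} {X : ℝ≥0 → Ω → Fin k} {Y : ℝ≥0 → Ω → ℝ}

lemma measurableSet_rect {s : ℝ≥0} {F : Set Ω} (hF : MeasurableSet[ℱ s] F) {B : Set ℝ}
    (hB : MeasurableSet B) :
    MeasurableSet[predictable ℱ] {p | s < p.2.1 ∧ p.1 ∈ F ∧ p.2.2 ∈ B} := by
  refine MeasurableSpace.measurableSet_generateFrom ⟨s, F, B, hF, hB, ?_⟩
  ext p
  simp only [mem_ofPred_eq, mem_prod, mem_Ioi]
  tauto

lemma measurable_time : Measurable[predictable ℱ] fun p : Ω × ℝ≥0 × ℝ => p.2.1 := by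
  refine @measurable_of_Ioi _ _ _ _ _ (predictable ℱ) _ _ _ _ fun s => ?_
  have h := measurableSet_rect (ℱ := ℱ) (s := s) (F := univ) .univ (B := univ) .univ
  convert h using 1
  ext p
  simp

lemma measurableSet_lt_time (s : ℝ≥0) :
    MeasurableSet[predictable ℱ] {p : Ω × ℝ≥0 × ℝ | s < p.2.1} :=
  measurable_time measurableSet_Ioi

-- A quantity known at time `s` is predictable only on times after `s`; a constant value before `s`
-- makes it a function on the whole space.
open Classical in
lemma measurable_ite_time {β : Type*} [MeasurableSpace β] (s : ℝ≥0) {f : Ω × ℝ≥0 × ℝ → β}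
    (hf : ∀ T, MeasurableSet T → MeasurableSet[predictable ℱ] {p | s < p.2.1 ∧ f p ∈ T}) (c : β) :
    Measurable[predictable ℱ] fun p => if s < p.2.1 then f p else c := by
  intro T hT
  have h : (fun p : Ω × ℝ≥0 × ℝ => if s < p.2.1 then f p else c) ⁻¹' T =
      {p | s < p.2.1 ∧ f p ∈ T} ∪ ({p | s < p.2.1}ᶜ ∩ {_p | c ∈ T}) := by
    ext p
    by_cases hp : s < p.2.1 <;> simp [hp]
  rw [h]
  exact (hf T hT).union ((measurableSet_lt_time s).compl.inter (MeasurableSet.const _))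

lemma measurableSet_age_mem (hY : Adapted ℱ Y) (s : ℝ≥0) {T : Set (ℝ × ℝ)}
    (hT : MeasurableSet T) : MeasurableSet[predictable ℱ]
      {p | s < p.2.1 ∧ (Y s p.1 + ((p.2.1 : ℝ) - s), p.2.2) ∈ T} := by
  classical
  have h1 : Measurable[predictable ℱ] fun p : Ω × ℝ≥0 × ℝ => if s < p.2.1 then Y s p.1 else 0 :=
    measurable_ite_time s (fun T hT => by
      simpa using measurableSet_rect (hY s hT) (B := univ) .univ) 0
  have h2 : Measurable[predictable ℱ] fun p : Ω × ℝ≥0 × ℝ => if s < p.2.1 then p.2.2 else 0 :=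
    measurable_ite_time s (fun T hT => by
      simpa using measurableSet_rect (ℱ := ℱ) (F := univ) .univ hT) 0
  have h3 : Measurable[predictable ℱ] fun p : Ω × ℝ≥0 × ℝ => (p.2.1 : ℝ) - s :=
    (measurable_coe_nnreal_real.comp measurable_time).sub_const _
  have h4 := (measurableSet_lt_time (ℱ := ℱ) s).inter (((h1.add h3).prodMk h2) hT)
  convert h4 using 1
  ext p
  simp only [mem_ofPred_eq, mem_inter_iff, mem_preimage, Pi.add_apply]
  refine and_congr_right fun hp => ?_
  rw [if_pos hp, if_pos hp]

/-- The points that belong to the next transition after an essential stopping time described by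
the events `A r ∈ ℱ_r`, as a predictable set. -/
def nextHitsPred (lam : Fin k → Fin k → ℝ → ℝ) (A : ℝ≥0 → Set Ω) (X : ℝ≥0 → Ω → Fin k)
    (Y : ℝ≥0 → Ω → ℝ) (i j : Fin k) (B : Set ℝ) : Set (Ω × ℝ≥0 × ℝ) :=
  {p | ∃ n, p.1 ∈ A (gridTime n) ∧ gridTime n < p.2.1 ∧
    (∀ m, gridTime m < p.2.1 → p.1 ∈ A (gridTime m) → X (gridTime m) p.1 = i) ∧
    0 < Y (gridTime n) p.1 + ((p.2.1 : ℝ) - gridTime n) ∧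
    Y (gridTime n) p.1 + ((p.2.1 : ℝ) - gridTime n) ∈ B ∧
    p.2.2 ∈ rateInterval lam i j (Y (gridTime n) p.1 + ((p.2.1 : ℝ) - gridTime n))}

lemma measurableSet_nextHitsPred (hlam : IsRate lam) (hX : Adapted ℱ X) (hY : Adapted ℱ Y)
    {A : ℝ≥0 → Set Ω} (hA : ∀ r, MeasurableSet[ℱ r] (A r)) {i j : Fin k} (hij : i ≠ j)
    {B : Set ℝ} (hB : MeasurableSet B) :
    MeasurableSet[predictable ℱ] (nextHitsPred lam A X Y i j B) := by
  have h : nextHitsPred lam A X Y i j B = ⋃ n,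
      {p | gridTime n < p.2.1 ∧ p.1 ∈ A (gridTime n) ∧ p.2.2 ∈ univ} ∩
      (⋂ m, {p | gridTime m < p.2.1 ∧
        p.1 ∈ A (gridTime m) ∩ {ω | X (gridTime m) ω = i}ᶜ ∧ p.2.2 ∈ univ}ᶜ) ∩
      {p | gridTime n < p.2.1 ∧ (Y (gridTime n) p.1 + ((p.2.1 : ℝ) - gridTime n), p.2.2) ∈
        {q : ℝ × ℝ | 0 < q.1 ∧ q.2 ∈ rateInterval lam i j q.1} ∩ B ×ˢ univ} := by
    ext p
    simp only [nextHitsPred, mem_ofPred_eq, mem_iUnion, mem_inter_iff, mem_iInter, mem_compl_iff,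
      mem_univ, and_true, mem_prod, not_and, not_not]
    refine exists_congr fun n => ?_
    tauto
  rw [h]
  refine MeasurableSet.iUnion fun n => ((measurableSet_rect (hA _) .univ).inter
    (MeasurableSet.iInter fun m => (measurableSet_rect ((hA _).inter ?_) .univ).compl)).inter
    (measurableSet_age_mem hY _ ((measurableSet_mem_rateInterval hlam hij).inter
      (hB.prod .univ)))
  exact (hX _ (measurableSet_singleton i)).compl

end Predictable

/-! ### From the dense times to all times -/

namespace PathSolution

variable {k : ℕ} {lam : Fin k → Fin k → ℝ → ℝ} {C : ℝ} {ν : Measure (ℝ≥0 × ℝ)}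
  {x : ℝ≥0 → Fin k} {y : ℝ≥0 → ℝ}

lemma exists_eq_right (hs : PathSolution lam C ν x y) (t : ℝ≥0) :
    ∃ v > t, ∀ s ∈ Ioo t v, x s = x t := by
  have h : ∀ᶠ s in 𝓝[>] t, x s ∈ ({x t} : Set (Fin k)) :=
    ((hs.cadlag_x.1 t).mono Ioi_subset_Ici_self).eventually_mem
      ((isOpen_discrete _).mem_nhds rfl)
  obtain ⟨v, hv, hsub⟩ := mem_nhdsGT_iff_exists_Ioo_subset.1 h
  exact ⟨v, hv, fun s hs => hsub hs⟩

lemma eq_of_gridTime (hs : PathSolution lam C ν x y) {τ u : ℝ≥0} {i : Fin k}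
    (h : ∀ n, τ < gridTime n → gridTime n < u → x (gridTime n) = i) {t : ℝ≥0} (hτt : τ ≤ t)
    (htu : t < u) : x t = i := by
  obtain ⟨v, hv, hc⟩ := hs.exists_eq_right t
  obtain ⟨n, hn, hn'⟩ := exists_gridTime_between (lt_min hv htu)
  rw [← hc _ ⟨hn, hn'.trans_le (min_le_left _ _)⟩]
  exact h n (hτt.trans_lt hn) (hn'.trans_le (min_le_right _ _))

lemma no_transition_of_eq {τ u : ℝ≥0} {i : Fin k}
    (h : ∀ t, τ ≤ t → t < u → x t = i) {v : ℝ≥0} (hv : v ∈ Ioo τ u) : v ∉ transitionSet x := by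
  intro hv'
  refine hv'.2 ?_
  have := neBot_nhdsLT hv'.1
  rw [h v hv.1.le hv.2]
  refine (leftLim_eq_of_tendsto (tendsto_const_nhds.congr' ?_)).symm
  filter_upwards [Ioo_mem_nhdsLT hv.1] with t ht using (h t ht.1.le (ht.2.trans hv.2)).symm

end PathSolution

/-- By right-continuity, staying in `i` on `[τ, u)` can be tested at grid times, and the age before
`u` is the age at any grid time in between plus the elapsed time. Since only grid times after `τ`
are needed and right-continuity recovers `τ` itself, it is harmless that `A r` is undetermined at `r
= τ`. -/
lemma section_nextHitsPred {Ω : Type*} {k : ℕ} {lam : Fin k → Fin k → ℝ → ℝ} {C : ℝ}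
    {X : ℝ≥0 → Ω → Fin k} {Y : ℝ≥0 → Ω → ℝ} {A : ℝ≥0 → Set Ω} {ω : Ω}
    {ν : Measure (ℝ≥0 × ℝ)} (hlam : IsRate lam)
    (hC : ∀ i j, i ≠ j → ∀ y, 0 < y → rateInterval lam i j y ⊆ Ico 0 C)
    (hs : PathSolution lam C ν (fun t => X t ω) (fun t => Y t ω)) {τ : ℝ≥0}
    (hA : ∀ r, (τ < r → ω ∈ A r) ∧ (ω ∈ A r → τ ≤ r)) (i j : Fin k) (B : Set ℝ) :
    Prod.mk ω ⁻¹' nextHitsPred lam A X Y i j B =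
      PathSolution.nextHits lam (fun t => X t ω) (fun t => Y t ω) τ i j B := by
  ext ⟨u, z⟩
  simp only [nextHitsPred, PathSolution.nextHits, mem_preimage, mem_ofPred_eq]
  constructor
  · rintro ⟨n, hn, hnu, hm, hpos, hB, hz⟩
    have hτu : τ < u := ((hA _).2 hn).trans_lt hnu
    have hconst : ∀ t, τ ≤ t → t < u → X t ω = i := fun t ht htu =>
      hs.eq_of_gridTime (fun m hm1 hm2 => hm m hm2 ((hA _).1 hm1)) ht htu
    have hno : ∀ v ∈ Ioo τ u, v ∉ transitionSet fun t => X t ω :=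
      fun v hv => PathSolution.no_transition_of_eq hconst hv
    have h1 := (hs.leftLim_of_no_transition hlam hC hτu hno).2
    have h2 := (hs.eq_of_no_transition hlam hC ((hA _).2 hn)
      fun v hv => hno v ⟨hv.1, hv.2.trans_lt hnu⟩).2
    have h3 : Function.leftLim (fun t => Y t ω) u = Y (gridTime n) ω + ((u : ℝ) - gridTime n) := by
      rw [h1, h2]
      ring
    rw [h3]
    exact ⟨hτu, hno, hconst τ le_rfl hτu, hB, hz⟩
  · rintro ⟨hτu, hno, hi, hB, hz⟩
    obtain ⟨n, hn, hnu⟩ := exists_gridTime_between hτu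
    have heq : ∀ t, τ ≤ t → t < u → X t ω = X τ ω ∧ Y t ω = Y τ ω + (t - τ : ℝ) :=
      fun t ht htu => hs.eq_of_no_transition hlam hC ht
        fun v hv => hno v ⟨hv.1, hv.2.trans_lt htu⟩
    have h1 := (hs.leftLim_of_no_transition hlam hC hτu hno).2
    have h3 : Function.leftLim (fun t => Y t ω) u = Y (gridTime n) ω + ((u : ℝ) - gridTime n) := by
      rw [h1, (heq _ hn.le hnu).2]
      ring
    have hpos := hs.leftLim_pos hC ((zero_le).trans_lt hτu)
    rw [h3] at hB hz hpos
    exact ⟨n, (hA _).1 hn, hnu, fun m hm1 hm2 => ((heq _ ((hA _).2 hm2) hm1).1).trans hi,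
      hpos, hB, hz⟩

/-! ### Integrals of the rates -/

lemma intervalIntegrable_of_bounded {f : ℝ → ℝ} {b : ℝ} (hf : Measurable f) (hb : ∀ s, |f s| ≤ b)
    (u v : ℝ) : IntervalIntegrable f volume u v :=
  (intervalIntegrable_const (c := b)).mono_fun' hf.aestronglyMeasurable
    (Eventually.of_forall hb)

lemma lipschitzWith_integral {f : ℝ → ℝ} {b : ℝ≥0} (hf : Measurable f) (hb : ∀ s, |f s| ≤ b) :
    LipschitzWith b fun y => ∫ s in (0 : ℝ)..y, f s := by
  refine LipschitzWith.of_dist_le_mul fun u v => ?_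
  rw [dist_eq_norm, intervalIntegral.integral_interval_sub_left
    (intervalIntegrable_of_bounded hf hb _ _) (intervalIntegrable_of_bounded hf hb _ _),
    Real.dist_eq]
  exact intervalIntegral.norm_integral_le_of_norm_le_const fun s _ => hb s

/-- The linear integral equation `G = p - ∫ r G` with a bounded measurable rate `r` is solved by
the exponential function only. -/
lemma eq_mul_exp_of_eq_sub_integral {r G : ℝ → ℝ} {b : ℝ≥0} {p : ℝ} (hr : Measurable r)
    (hrb : ∀ s, |r s| ≤ b) (hG : Measurable G) (hGb : ∀ s, |G s| ≤ 1)
    (h : ∀ s, 0 < s → G s = p - ∫ v in (0 : ℝ)..s, r v * G v) {y : ℝ} (hy : 0 < y) :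
    G y = p * Real.exp (-∫ v in (0 : ℝ)..y, r v) := by
  have hrGb : ∀ s, |r s * G s| ≤ b := fun s => by
    rw [abs_mul]
    exact (mul_le_mul (hrb s) (hGb s) (abs_nonneg _) b.2).trans_eq (mul_one _)
  -- `G` is only measurable, so the argument uses its absolutely continuous version `W`: the product
  -- `W exp(Λ)` has derivative zero almost everywhere and is therefore constant.
  set W : ℝ → ℝ := fun y => p - ∫ v in (0 : ℝ)..y, r v * G v with hW
  set Λ : ℝ → ℝ := fun y => ∫ v in (0 : ℝ)..y, r v with hΛ
  have hΛlip : LipschitzWith b Λ := lipschitzWith_integral hr hrb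
  have hWac : AbsolutelyContinuousOnInterval W 0 y :=
    (((LipschitzWith.const p).sub (lipschitzWith_integral (hr.mul hG) hrGb)).lipschitzOnWith
      (s := uIcc 0 y)).absolutelyContinuousOnInterval
  have hEac : AbsolutelyContinuousOnInterval (fun s => Real.exp (Λ s)) 0 y := by
    -- The exponential is Lipschitz only on compacts; on `[0, y]` the exponent stays in `[-by, by]`.
    obtain ⟨K, hK⟩ := (Real.contDiff_exp (n := 1)).contDiffOn.exists_lipschitzOnWith
      (s := Icc (-(b * y)) (b * y)) (by decide) (convex_Icc _ _) isCompact_Icc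
    refine (hK.comp (hΛlip.lipschitzOnWith (s := uIcc 0 y))
      fun s hs => ?_).absolutelyContinuousOnInterval
    rw [uIcc_of_le hy.le] at hs
    have h1 : |Λ s| ≤ b * s := by
      have h2 := hΛlip.dist_le_mul s 0
      simpa [hΛ, Real.dist_eq, abs_of_nonneg hs.1] using h2
    have h3 : (b : ℝ) * s ≤ b * y := mul_le_mul_of_nonneg_left hs.2 b.2
    exact abs_le.1 (h1.trans h3)
  obtain ⟨c, hc⟩ := (hWac.fun_mul hEac).const_of_ae_hasDerivAt_zero (by
    have hloc : ∀ {f : ℝ → ℝ}, Measurable f → (∀ s, |f s| ≤ b) →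
        ∀ᵐ s, s ∈ uIcc 0 y → HasDerivAt (fun u => ∫ v in (0 : ℝ)..u, f v) (f s) s :=
      fun hf hfb => by
        filter_upwards [(intervalIntegrable_of_bounded hf hfb 0 y).ae_hasDerivAt_integral]
          with s hs hsy using hs hsy 0 left_mem_uIcc
    filter_upwards [hloc hr hrb, hloc (hr.mul hG) hrGb, Measure.ae_ne volume 0]
      with s h1 h2 hs0 hs
    have hspos : 0 < s := by
      rw [uIcc_of_le hy.le] at hs
      exact hs.1.lt_of_ne' hs0
    have h3 := ((h2 hs).const_sub p).mul (h1 hs).exp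
    refine h3.congr_deriv ?_
    change -(r s * G s) * Real.exp (Λ s) + (p - ∫ v in (0 : ℝ)..s, r v * G v) *
      (Real.exp (Λ s) * r s) = 0
    rw [← h s hspos]
    ring)
  have h0 := hc 0 left_mem_uIcc
  have h1 := hc y right_mem_uIcc
  simp only [hW, hΛ, intervalIntegral.integral_same, sub_zero, Real.exp_zero, mul_one] at h0
  have h2 : W y = G y := (h y hy).symm
  rw [Real.exp_neg, ← div_eq_mul_inv, eq_div_iff (Real.exp_pos _).ne', ← h2, h0]
  exact h1

section

variable {k : ℕ} {lam : Fin k → Fin k → ℝ → ℝ}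

lemma posRate_nonneg (hlam : IsRate lam) {i j : Fin k} (hij : i ≠ j) (y : ℝ) :
    0 ≤ posRate lam i j y :=
  indicator_nonneg (fun y hy => hlam.nonneg i j hij y hy) y

lemma exitRate_posRate_of_pos {i : Fin k} {y : ℝ} (hy : 0 < y) :
    exitRate (posRate lam) i y = exitRate lam i y :=
  Finset.sum_congr rfl fun _ _ => posRate_of_pos hy

lemma measurable_exitRate_posRate (hlam : IsRate lam) (i : Fin k) :
    Measurable (exitRate (posRate lam) i) := by
  unfold exitRate
  exact Finset.measurable_sum _ fun j hj =>
    measurable_posRate hlam (Finset.mem_filter.1 hj).2.symm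

lemma posRate_le_exitRate (hlam : IsRate lam) {i j : Fin k} (hij : i ≠ j) (y : ℝ) :
    posRate lam i j y ≤ exitRate (posRate lam) i y :=
  Finset.single_le_sum (f := fun j => posRate lam i j y)
    (fun _ hl => posRate_nonneg hlam (Finset.mem_filter.1 hl).2.symm y)
    (Finset.mem_filter.2 ⟨Finset.mem_univ j, hij.symm⟩)

lemma exitRate_posRate_nonneg (hlam : IsRate lam) (i : Fin k) (y : ℝ) :
    0 ≤ exitRate (posRate lam) i y :=
  Finset.sum_nonneg fun _ hl => posRate_nonneg hlam (Finset.mem_filter.1 hl).2.symm y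

lemma exists_exitRate_le (hlam : IsRate lam) (i : Fin k) :
    ∃ b : ℝ≥0, ∀ y, |exitRate (posRate lam) i y| ≤ b := by
  obtain ⟨b, hb⟩ := hlam.bounded i
  refine ⟨b.toNNReal, fun y => ?_⟩
  rw [abs_of_nonneg (exitRate_posRate_nonneg hlam i y)]
  rcases lt_or_ge 0 y with hy | hy
  · rw [exitRate_posRate_of_pos hy]
    exact (hb ⟨y, hy, rfl⟩).trans (Real.le_coe_toNNReal b)
  · refine (Finset.sum_eq_zero fun j _ => ?_).le.trans (NNReal.coe_nonneg _)
    exact indicator_of_notMem (notMem_Ioi.2 hy) _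

lemma intervalIntegrable_posRate (hlam : IsRate lam) {i j : Fin k} (hij : i ≠ j) (u v : ℝ) :
    IntervalIntegrable (posRate lam i j) volume u v := by
  obtain ⟨b, hb⟩ := exists_exitRate_le hlam i
  refine intervalIntegrable_of_bounded (b := b) (measurable_posRate hlam hij) (fun s => ?_) u v
  rw [abs_of_nonneg (posRate_nonneg hlam hij s)]
  exact (posRate_le_exitRate hlam hij s).trans ((le_abs_self _).trans (hb s))

lemma integral_congr_of_pos {f g : ℝ → ℝ} (h : ∀ s, 0 < s → f s = g s) {u v : ℝ} (hu : 0 ≤ u)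
    (huv : u ≤ v) : ∫ s in u..v, f s = ∫ s in u..v, g s := by
  refine intervalIntegral.integral_congr_ae (Eventually.of_forall fun s hs => h s ?_)
  rw [uIoc_of_le huv] at hs
  exact hu.trans_lt hs.1

lemma cumRate_eq (i : Fin k) {y : ℝ} (hy : 0 ≤ y) :
    cumRate lam i y = ∫ v in (0 : ℝ)..y, exitRate (posRate lam) i v :=
  integral_congr_of_pos (fun _ hs => (exitRate_posRate_of_pos hs).symm) le_rfl hy

/-- From every age on, the rates of leaving `i` have infinite total mass. -/
lemma exists_lintegral_rate_eq_top (hlam : IsRate lam) (i : Fin k) {a : ℝ} (ha : 0 ≤ a) :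
    ∃ j, i ≠ j ∧ ∫⁻ s in Ioi 0, ENNReal.ofReal (lam i j (a + s)) = ∞ := by
  by_contra! hcon
  set K : ℝ := ∑ j ∈ Finset.univ.filter (fun j => j ≠ i),
    (∫⁻ s in Ioi 0, ENNReal.ofReal (lam i j (a + s))).toReal with hK
  -- If every target had finite mass, `Λ_i` would stay bounded beyond `a`, against its divergence.
  have hbound : ∀ y, a ≤ y → cumRate lam i y ≤ cumRate lam i a + K := by
    intro y hay
    have hexit : ∀ v, exitRate (posRate lam) i v =
      ∑ j ∈ Finset.univ.filter (fun j => j ≠ i), posRate lam i j v := fun v => rfl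
    obtain ⟨b, hb⟩ := exists_exitRate_le hlam i
    have hint := intervalIntegrable_of_bounded (measurable_exitRate_posRate hlam i) hb
    rw [cumRate_eq i (ha.trans hay), cumRate_eq i ha,
      ← intervalIntegral.integral_add_adjacent_intervals (hint 0 a) (hint a y)]
    gcongr
    simp_rw [hexit]
    rw [intervalIntegral.integral_finsetSum fun j hj =>
      intervalIntegrable_posRate hlam (Finset.mem_filter.1 hj).2.symm a y]
    refine Finset.sum_le_sum fun j hj => ?_
    have hij : i ≠ j := (Finset.mem_filter.1 hj).2.symm
    rw [intervalIntegral.integral_of_le hay, integral_eq_lintegral_of_nonneg_ae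
      (Eventually.of_forall fun s => posRate_nonneg hlam hij s)
      (measurable_posRate hlam hij).aestronglyMeasurable]
    refine ENNReal.toReal_mono (hcon j hij) ?_
    rw [← lintegral_indicator measurableSet_Ioc, ← lintegral_indicator measurableSet_Ioi,
      ← lintegral_add_left_eq_self _ a]
    refine lintegral_mono fun s => ?_
    by_cases hs : a + s ∈ Ioc a y
    · have hs0 : 0 < s := by linarith [hs.1]
      rw [indicator_of_mem hs, indicator_of_mem (mem_Ioi.2 hs0), posRate_of_pos (by linarith)]
    · rw [indicator_of_notMem hs]
      exact zero_le
  obtain ⟨y, hy1, hy2⟩ := ((hlam.tendsto_cumRate i).eventually_gt_atTop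
    (cumRate lam i a + K)).and (eventually_ge_atTop a) |>.exists
  exact (hbound y hy2).not_gt hy1

lemma lintegral_volumeNNReal (H : ℝ → ℝ≥0∞) :
    ∫⁻ u, H u ∂volumeNNReal = ∫⁻ r in Ici 0, H r := by
  have he : MeasurableEmbedding (fun u : ℝ≥0 => (u : ℝ)) :=
    MeasurableEmbedding.subtype_coe measurableSet_Ici
  rw [volumeNNReal, ← he.lintegral_map, he.map_comap]
  congr 2
  ext r
  exact ⟨fun ⟨u, hu⟩ => hu ▸ u.2, fun hr => ⟨⟨r, hr⟩, rfl⟩⟩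

-- By Fubini in time and mark: the section at time `u` is `Λ_ij` at the age `y τ + (u - τ)`, of
-- length the rate there. The set `L` records for which elapsed times no transition has yet
-- occurred.
open Classical in
lemma intensity_nextHits (hlam : IsRate lam) {C : ℝ}
    (hC : ∀ i j, i ≠ j → ∀ y, 0 < y → rateInterval lam i j y ⊆ Ico 0 C)
    {ν : Measure (ℝ≥0 × ℝ)} {x : ℝ≥0 → Fin k} {y : ℝ≥0 → ℝ} (hs : PathSolution lam C ν x y)
    {τ : ℝ≥0} {L : Set ℝ}
    (hL : ∀ u, τ < u → ((∀ v ∈ Ioo τ u, v ∉ transitionSet x) ↔ (u : ℝ) - τ ∈ L)) {i j : Fin k}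
    {B : Set ℝ} (hm : MeasurableSet (PathSolution.nextHits lam x y τ i j B)) :
    intensity (PathSolution.nextHits lam x y τ i j B) = if x τ = i then
      ∫⁻ s, (Ioi 0 ∩ L ∩ {s | y τ + s ∈ B}).indicator
        (fun s => ENNReal.ofReal (lam i j (y τ + s))) s else 0 := by
  split_ifs with hi
  · set H : ℝ → ℝ≥0∞ := (Ioi 0 ∩ L ∩ {s | y τ + s ∈ B}).indicator
      (fun s => ENNReal.ofReal (lam i j (y τ + s))) with hH
    have hsec : ∀ u : ℝ≥0, volume (Prod.mk u ⁻¹' PathSolution.nextHits lam x y τ i j B) =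
        H ((u : ℝ) - τ) := by
      intro u
      by_cases hu : τ < u ∧ (∀ v ∈ Ioo τ u, v ∉ transitionSet x)
      · have hleft := (hs.leftLim_of_no_transition hlam hC hu.1 hu.2).2
        have hpos : (0 : ℝ) < u - τ := sub_pos.2 (by exact_mod_cast hu.1)
        by_cases hB : y τ + ((u : ℝ) - τ) ∈ B
        · have hmem : (u : ℝ) - τ ∈ Ioi 0 ∩ L ∩ {s | y τ + s ∈ B} :=
            ⟨⟨hpos, (hL u hu.1).1 hu.2⟩, hB⟩
          rw [hH, indicator_of_mem hmem, ← volume_rateInterval]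
          congr 1
          ext z
          simp only [PathSolution.nextHits, mem_preimage, mem_ofPred_eq, hleft]
          exact ⟨fun h => h.2.2.2.2, fun h => ⟨hu.1, hu.2, hi, hB, h⟩⟩
        · rw [hH, indicator_of_notMem fun h => hB h.2]
          convert measure_empty (μ := (volume : Measure ℝ))
          refine eq_empty_of_forall_notMem fun z hz => hB ?_
          rw [← hleft]
          exact hz.2.2.2.1
      · rw [hH, indicator_of_notMem]
        · convert measure_empty (μ := (volume : Measure ℝ))
          exact eq_empty_of_forall_notMem fun z hz => hu ⟨hz.1, hz.2.1⟩
        · intro h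
          have hτu : τ < u := by exact_mod_cast (sub_pos (α := ℝ)).1 h.1.1
          exact hu ⟨hτu, (hL u hτu).2 h.1.2⟩
    rw [intensity_eq_prod, Measure.prod_apply hm]
    simp_rw [hsec]
    rw [lintegral_volumeNNReal fun r => H (r - τ), ← lintegral_sub_right_eq_self H (τ : ℝ),
      ← lintegral_indicator measurableSet_Ici]
    refine lintegral_congr fun r => ?_
    by_cases hr : r ∈ Ici (0 : ℝ)
    · rw [indicator_of_mem hr]
    · rw [indicator_of_notMem hr, hH, indicator_of_notMem]
      intro h
      exact hr ((τ.2.trans (sub_pos.1 h.1.1).le : (0 : ℝ) ≤ r))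
  · convert measure_empty (μ := intensity)
    exact eq_empty_of_forall_notMem fun p hp => hi hp.2.2.1

end

/-! ### One transition -/

section

variable {Ω : Type*} [mΩ : MeasurableSpace Ω]

/-- `τ` is almost surely determined by events `A r ∈ ℱ_r` that lie between `{τ < r}` and
`{τ ≤ r}`. -/
structure IsEssStopping (ℱ : Filtration ℝ≥0 mΩ) (P : Measure Ω) (A : ℝ≥0 → Set Ω)
    (τ : Ω → ℝ≥0) : Prop where
  measurableSet : ∀ r, MeasurableSet[ℱ r] (A r)
  ae_mem : ∀ᵐ ω ∂P, ∀ r, (τ ω < r → ω ∈ A r) ∧ (ω ∈ A r → τ ω ≤ r)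

/-- The first transition time after `τ`. -/
def nextTime {β : Type*} [TopologicalSpace β] (X : ℝ≥0 → Ω → β) (τ : Ω → ℝ≥0) (ω : Ω) : ℝ≥0 :=
  sInf {t | t ∈ transitionSet (fun t => X t ω) ∧ τ ω < t}

variable {P : Measure Ω} {ℱ : Filtration ℝ≥0 mΩ} {A : ℝ≥0 → Set Ω} {τ : Ω → ℝ≥0}

/-- Up to a null set, `{τ < r}` is the union of the events `A` at grid times before `r`. -/
lemma IsEssStopping.aemeasurable (hτ : IsEssStopping ℱ P A τ) : AEMeasurable τ P := by
  refine NullMeasurable.aemeasurable (f := τ) ?_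
  refine @measurable_of_Iio _ (NullMeasurableSpace Ω P) _ _ _ _ _ _ _ _ fun r => ?_
  have hm : MeasurableSet (⋃ n ∈ {n | gridTime n < r}, A (gridTime n)) :=
    MeasurableSet.biUnion (to_countable _) fun n _ => ℱ.le _ _ (hτ.measurableSet _)
  refine hm.nullMeasurableSet.congr ?_
  filter_upwards [hτ.ae_mem] with ω hω
  refine propext ⟨fun h => ?_, fun h => ?_⟩
  · obtain ⟨n, hn, hA⟩ := mem_iUnion₂.1 h
    exact ((hω _).2 hA).trans_lt hn
  · obtain ⟨n, hn, hn'⟩ := exists_gridTime_between (show τ ω < r from h)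
    exact mem_iUnion₂.2 ⟨n, hn', (hω _).1 hn⟩

variable [IsProbabilityMeasure P] {k : ℕ} {lam : Fin k → Fin k → ℝ → ℝ}
  {N : Ω → Measure (ℝ≥0 × ℝ)} {X : ℝ≥0 → Ω → Fin k} {Y : ℝ≥0 → Ω → ℝ} {C : ℝ}

/-- The random set of points that belong to the first transition after `τ`. -/
def randomNextHits (lam : Fin k → Fin k → ℝ → ℝ) (X : ℝ≥0 → Ω → Fin k) (Y : ℝ≥0 → Ω → ℝ)
    (τ : Ω → ℝ≥0) (i j : Fin k) (B : Set ℝ) (ω : Ω) : Set (ℝ≥0 × ℝ) :=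
  PathSolution.nextHits lam (fun t => X t ω) (fun t => Y t ω) (τ ω) i j B

lemma ae_section_nextHitsPred (hlam : IsRate lam)
    (hC : ∀ i j, i ≠ j → ∀ y, 0 < y → rateInterval lam i j y ⊆ Ico 0 C) (hC0 : 0 ≤ C)
    (hN : IsPoissonRelTo N ℱ P) (hXY : IsStrongSolution lam N ℱ P X Y)
    (hτ : IsEssStopping ℱ P A τ) {i j : Fin k} (hij : i ≠ j) {B : Set ℝ} :
    ∀ᵐ ω ∂P, Prod.mk ω ⁻¹' nextHitsPred lam A X Y i j B ∩ Ioi 0 ×ˢ Ico 0 C =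
        randomNextHits lam X Y τ i j B ω ∧
      Prod.mk ω ⁻¹' nextHitsPred lam A X Y i j B = randomNextHits lam X Y τ i j B ω := by
  filter_upwards [hτ.ae_mem, ae_pathSolution hN hXY hC0] with ω hA hs
  have h := section_nextHitsPred hlam hC hs hA i j B
  refine ⟨?_, h⟩
  rw [h]
  refine inter_eq_left.2 fun p hp => ?_
  have hp' := hs.nextHits_subset_hits hlam hC hij hp
  exact hs.hits_subset hC (Ioi 0) ⟨⟨hp'.1, mem_univ _⟩, hp'⟩

lemma aemeasurable_randomNextHits (hlam : IsRate lam)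
    (hC : ∀ i j, i ≠ j → ∀ y, 0 < y → rateInterval lam i j y ⊆ Ico 0 C) (hC0 : 0 ≤ C)
    (hN : IsPoissonRelTo N ℱ P) (hXY : IsStrongSolution lam N ℱ P X Y)
    (hτ : IsEssStopping ℱ P A τ) {i j : Fin k} (hij : i ≠ j) {B : Set ℝ} (hB : MeasurableSet B) :
    AEMeasurable (fun ω => N ω (randomNextHits lam X Y τ i j B ω)) P := by
  refine (aemeasurable_section hN.poisson (C := C) (predictable_le _
    (measurableSet_nextHitsPred hlam hXY.adapted_X hXY.adapted_Y hτ.measurableSet hij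
      hB))).congr ?_
  filter_upwards [ae_section_nextHitsPred hlam hC hC0 hN hXY hτ hij (B := B)] with ω hω
  rw [hω.1]

lemma ae_measurableSet_randomNextHits (hlam : IsRate lam)
    (hC : ∀ i j, i ≠ j → ∀ y, 0 < y → rateInterval lam i j y ⊆ Ico 0 C) (hC0 : 0 ≤ C)
    (hN : IsPoissonRelTo N ℱ P) (hXY : IsStrongSolution lam N ℱ P X Y)
    (hτ : IsEssStopping ℱ P A τ) {i j : Fin k} (hij : i ≠ j) {B : Set ℝ} (hB : MeasurableSet B) :
    ∀ᵐ ω ∂P, MeasurableSet (randomNextHits lam X Y τ i j B ω) := by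
  filter_upwards [ae_section_nextHitsPred hlam hC hC0 hN hXY hτ hij (B := B)] with ω hω
  rw [← hω.2]
  exact measurable_prodMk_left (predictable_le _
    (measurableSet_nextHitsPred hlam hXY.adapted_X hXY.adapted_Y hτ.measurableSet hij hB))

lemma aemeasurable_intensity_randomNextHits (hlam : IsRate lam)
    (hC : ∀ i j, i ≠ j → ∀ y, 0 < y → rateInterval lam i j y ⊆ Ico 0 C) (hC0 : 0 ≤ C)
    (hN : IsPoissonRelTo N ℱ P) (hXY : IsStrongSolution lam N ℱ P X Y)
    (hτ : IsEssStopping ℱ P A τ) {i j : Fin k} (hij : i ≠ j) {B : Set ℝ} (hB : MeasurableSet B) :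
    AEMeasurable (fun ω => intensity (randomNextHits lam X Y τ i j B ω)) P := by
  have : SFinite intensity := by
    rw [intensity_eq_prod]
    infer_instance
  refine (measurable_measure_prodMk_left (ν := intensity) (predictable_le _
    (measurableSet_nextHitsPred hlam hXY.adapted_X hXY.adapted_Y hτ.measurableSet hij
      hB))).aemeasurable.congr ?_
  filter_upwards [ae_section_nextHitsPred hlam hC hC0 hN hXY hτ hij (B := B)] with ω hω
  rw [hω.2]

lemma lintegral_randomNextHits (hlam : IsRate lam)
    (hC : ∀ i j, i ≠ j → ∀ y, 0 < y → rateInterval lam i j y ⊆ Ico 0 C) (hC0 : 0 ≤ C)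
    (hN : IsPoissonRelTo N ℱ P) (hXY : IsStrongSolution lam N ℱ P X Y)
    (hτ : IsEssStopping ℱ P A τ) {i j : Fin k} (hij : i ≠ j) {B : Set ℝ} (hB : MeasurableSet B) :
    ∫⁻ ω, N ω (randomNextHits lam X Y τ i j B ω) ∂P =
      ∫⁻ ω, intensity (randomNextHits lam X Y τ i j B ω) ∂P := by
  have hae := ae_section_nextHitsPred hlam hC hC0 hN hXY hτ hij (B := B)
  have h := lintegral_section hN (C := C)
    (measurableSet_nextHitsPred hlam hXY.adapted_X hXY.adapted_Y hτ.measurableSet hij hB)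
  rwa [lintegral_congr_ae (hae.mono fun ω hω => congrArg (N ω) hω.1),
    lintegral_congr_ae (hae.mono fun ω hω => congrArg intensity hω.1)] at h

/-- The count of next hits is at most one, so by compensation their intensity has mean at most one
and is almost surely finite. Without a further transition it would be `∫_0^∞ λ_ij(Y_τ + s) ds`,
which is infinite for some `j`. -/
lemma ae_exists_transition (hlam : IsRate lam)
    (hC : ∀ i j, i ≠ j → ∀ y, 0 < y → rateInterval lam i j y ⊆ Ico 0 C) (hC0 : 0 ≤ C)
    (hN : IsPoissonRelTo N ℱ P) (hXY : IsStrongSolution lam N ℱ P X Y)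
    (hτ : IsEssStopping ℱ P A τ) :
    ∀ᵐ ω ∂P, ∃ t, t ∈ transitionSet (fun t => X t ω) ∧ τ ω < t := by
  classical
  have hfin : ∀ i j, i ≠ j →
      ∀ᵐ ω ∂P, intensity (randomNextHits lam X Y τ i j univ ω) < ∞ := by
    intro i j hij
    refine ae_lt_top' (aemeasurable_intensity_randomNextHits hlam hC hC0 hN hXY hτ hij .univ)
      (ne_top_of_le_ne_top ENNReal.one_ne_top ?_)
    rw [← lintegral_randomNextHits hlam hC hC0 hN hXY hτ hij .univ]
    calc ∫⁻ ω, N ω (randomNextHits lam X Y τ i j univ ω) ∂P ≤ ∫⁻ _, 1 ∂P := by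
          refine lintegral_mono_ae ?_
          filter_upwards [ae_pathSolution hN hXY hC0] with ω hs
          by_cases hne : ∃ t, t ∈ transitionSet (fun t => X t ω) ∧ τ ω < t
          · obtain ⟨h1, h2, h3⟩ := hs.sInf_transition hC hne
            rw [randomNextHits, hs.measure_nextHits hlam hC h2 h1 h3 hij]
            split_ifs <;> simp
          · rw [randomNextHits, hs.measure_nextHits_of_none hlam hC
              (fun t ht ht' => hne ⟨t, ht', ht⟩) hij]
            exact zero_le
      _ = 1 := by simp
  have hfin' : ∀ᵐ ω ∂P, ∀ i j, i ≠ j → intensity (randomNextHits lam X Y τ i j univ ω) < ∞ := by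
    rw [ae_all_iff]
    refine fun i => ae_all_iff.2 fun j => ?_
    by_cases hij : i = j
    · exact Eventually.of_forall fun _ h => absurd hij h
    · exact (hfin i j hij).mono fun _ h _ => h
  have hmeas : ∀ᵐ ω ∂P, ∀ i j, i ≠ j → MeasurableSet (randomNextHits lam X Y τ i j univ ω) := by
    rw [ae_all_iff]
    refine fun i => ae_all_iff.2 fun j => ?_
    by_cases hij : i = j
    · exact Eventually.of_forall fun _ h => absurd hij h
    · exact (ae_measurableSet_randomNextHits hlam hC hC0 hN hXY hτ hij .univ).mono fun _ h _ => h
  filter_upwards [hfin', hmeas, ae_pathSolution hN hXY hC0] with ω h1 h2 hs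
  by_contra hne
  obtain ⟨j, hij, htop⟩ := exists_lintegral_rate_eq_top hlam (X (τ ω) ω) (hs.nonneg (τ ω))
  refine (h1 _ j hij).ne ?_
  -- `L = univ`: no elapsed time is excluded when no transition follows.
  rw [randomNextHits, intensity_nextHits hlam hC hs (L := univ) _ (h2 _ j hij), if_pos rfl, ← htop,
    ← lintegral_indicator measurableSet_Ioi]
  · simp
  · exact fun u _ => ⟨fun _ => mem_univ _, fun _ v hv hv' => hne ⟨v, hv', hv.1⟩⟩

lemma ae_nextTime (hlam : IsRate lam)
    (hC : ∀ i j, i ≠ j → ∀ y, 0 < y → rateInterval lam i j y ⊆ Ico 0 C) (hC0 : 0 ≤ C)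
    (hN : IsPoissonRelTo N ℱ P) (hXY : IsStrongSolution lam N ℱ P X Y)
    (hτ : IsEssStopping ℱ P A τ) :
    ∀ᵐ ω ∂P, nextTime X τ ω ∈ transitionSet (fun t => X t ω) ∧ τ ω < nextTime X τ ω ∧
      ∀ u ∈ Ioo (τ ω) (nextTime X τ ω), u ∉ transitionSet (fun t => X t ω) := by
  filter_upwards [ae_exists_transition hlam hC hC0 hN hXY hτ, ae_pathSolution hN hXY hC0]
    with ω hne hs
  exact hs.sInf_transition hC hne

/-- Events that describe the first transition after a time described by the events `A r`. -/
def nextEvent (A : ℝ≥0 → Set Ω) (X : ℝ≥0 → Ω → Fin k) (r : ℝ≥0) : Set Ω :=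
  ⋃ n ∈ {n | gridTime n ≤ r}, ⋃ m ∈ {m | gridTime m < gridTime n},
    A (gridTime m) ∩ {ω | X (gridTime m) ω = X (gridTime n) ω}ᶜ

/-- A transition has occurred once two grid times after `τ` show different states. A change exactly
at `r` may be missed and is seen only after `r`, which the gap between `{σ < r}` and `{σ ≤ r}`
allows. -/
lemma isEssStopping_nextTime (hlam : IsRate lam)
    (hC : ∀ i j, i ≠ j → ∀ y, 0 < y → rateInterval lam i j y ⊆ Ico 0 C) (hC0 : 0 ≤ C)
    (hN : IsPoissonRelTo N ℱ P) (hXY : IsStrongSolution lam N ℱ P X Y)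
    (hτ : IsEssStopping ℱ P A τ) : IsEssStopping ℱ P (nextEvent A X) (nextTime X τ) := by
  refine ⟨fun r => ?_, ?_⟩
  · refine MeasurableSet.biUnion (to_countable _) fun n hn =>
      MeasurableSet.biUnion (to_countable _) fun m hm => ?_
    have hmr : gridTime m ≤ r := (le_of_lt hm).trans hn
    refine (ℱ.mono hmr _ (hτ.measurableSet _)).inter (MeasurableSet.compl ?_)
    have h1 : Measurable[ℱ r] (X (gridTime m)) := (hXY.adapted_X _).mono (ℱ.mono hmr) le_rfl
    have h2 : Measurable[ℱ r] (X (gridTime n)) := (hXY.adapted_X _).mono (ℱ.mono hn) le_rfl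
    exact measurableSet_eq_fun h1 h2
  · filter_upwards [hτ.ae_mem, ae_nextTime hlam hC hC0 hN hXY hτ, ae_pathSolution hN hXY hC0]
      with ω hA hσ hs r
    obtain ⟨htr, hlt, hno⟩ := hσ
    constructor
    · intro hr
      obtain ⟨m, hm, hm'⟩ := exists_gridTime_between hlt
      obtain ⟨v, hv, hc⟩ := hs.exists_eq_right (nextTime X τ ω)
      obtain ⟨n, hn, hn'⟩ := exists_gridTime_between (lt_min hv hr)
      refine mem_iUnion₂.2 ⟨n, (hn'.trans_le (min_le_right _ _)).le,
        mem_iUnion₂.2 ⟨m, hm'.trans hn, (hA _).1 hm, fun heq => htr.2 ?_⟩⟩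
      have h1 := (hs.leftLim_of_no_transition hlam hC hlt hno).1
      have h2 := (hs.eq_of_no_transition hlam hC hm.le
        fun u hu => hno u ⟨hu.1, hu.2.trans_lt hm'⟩).1
      have h3 := hc _ ⟨hn, hn'.trans_le (min_le_left _ _)⟩
      change X (gridTime m) ω = X (gridTime n) ω at heq
      rw [h1, ← h2]
      exact h3.symm.trans heq.symm
    · intro h
      obtain ⟨n, hn, h⟩ := mem_iUnion₂.1 h
      obtain ⟨m, hm, hAm, hne⟩ := mem_iUnion₂.1 h
      by_contra hr
      refine hne (hs.eq_of_no_transition hlam hC (le_of_lt hm) fun u hu => hno u ⟨?_, ?_⟩).1.symm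
      · exact ((hA _).2 hAm).trans_lt hu.1
      · exact hu.2.trans_lt (lt_of_le_of_lt hn (not_le.1 hr))

/-- By right-continuity, `X_τ = i` exactly when the state is `i` at all grid times in some interval
to the right of `τ`. -/
lemma nullMeasurableSet_state (hC0 : 0 ≤ C) (hN : IsPoissonRelTo N ℱ P)
    (hXY : IsStrongSolution lam N ℱ P X Y) (hτ : IsEssStopping ℱ P A τ) (i : Fin k) :
    NullMeasurableSet {ω | X (τ ω) ω = i} P := by
  have hlt : ∀ r, NullMeasurableSet {ω | τ ω < r} P := fun r =>
    hτ.aemeasurable.nullMeasurableSet_preimage measurableSet_Iio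
  have hXm : ∀ n, NullMeasurableSet {ω | X (gridTime n) ω = i} P := fun n =>
    (ℱ.le _ _ (hXY.adapted_X _ (measurableSet_singleton i))).nullMeasurableSet
  have hm : NullMeasurableSet (⋃ n, {ω | τ ω < gridTime n} ∩
      ⋂ m ∈ {m | gridTime m < gridTime n},
        ({ω | τ ω < gridTime m} ∩ {ω | X (gridTime m) ω = i}ᶜ)ᶜ) P :=
    NullMeasurableSet.iUnion fun n => (hlt _).inter
      (NullMeasurableSet.biInter (to_countable _) fun m _ => ((hlt _).inter (hXm m).compl).compl)
  refine hm.congr ?_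
  filter_upwards [ae_pathSolution hN hXY hC0] with ω hs
  refine propext ⟨fun h => ?_, fun h => ?_⟩
  · obtain ⟨n, hn, hn'⟩ := mem_iUnion.1 h
    refine hs.eq_of_gridTime (u := gridTime n) (fun m hm hm' => ?_) le_rfl hn
    by_contra hne
    exact mem_iInter₂.1 hn' m hm' ⟨hm, hne⟩
  · obtain ⟨v, hv, hc⟩ := hs.exists_eq_right (τ ω)
    obtain ⟨n, hn, hn'⟩ := exists_gridTime_between hv
    refine mem_iUnion.2 ⟨n, hn, mem_iInter₂.2 fun m hm hm' => hm'.2 ?_⟩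
    exact (hc _ ⟨hm'.1, lt_trans hm hn'⟩).trans h

end

/-! ### The law of the next transition -/

section

variable {Ω : Type*} [mΩ : MeasurableSpace Ω] {P : Measure Ω} {ℱ : Filtration ℝ≥0 mΩ}
  {A : ℝ≥0 → Set Ω} {τ : Ω → ℝ≥0} [IsProbabilityMeasure P] {k : ℕ}
  {lam : Fin k → Fin k → ℝ → ℝ} {N : Ω → Measure (ℝ≥0 × ℝ)} {X : ℝ≥0 → Ω → Fin k}
  {Y : ℝ≥0 → Ω → ℝ} {C : ℝ}

/-- The next transition after `τ` leads from `i` to `j`, at an age not larger than `y`. -/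
def moveEvent (X : ℝ≥0 → Ω → Fin k) (Y : ℝ≥0 → Ω → ℝ) (τ : Ω → ℝ≥0) (i j : Fin k) (y : ℝ) :
    Set Ω :=
  {ω | X (τ ω) ω = i ∧ X (nextTime X τ ω) ω = j ∧
    Function.leftLim (fun t => Y t ω) (nextTime X τ ω) ≤ y}

open Classical in
lemma ae_count_eq_indicator (hlam : IsRate lam)
    (hC : ∀ i j, i ≠ j → ∀ y, 0 < y → rateInterval lam i j y ⊆ Ico 0 C) (hC0 : 0 ≤ C)
    (hN : IsPoissonRelTo N ℱ P) (hXY : IsStrongSolution lam N ℱ P X Y)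
    (hτ : IsEssStopping ℱ P A τ) {i j : Fin k} (hij : i ≠ j) (y : ℝ) :
    (fun ω => N ω (randomNextHits lam X Y τ i j (Iic y) ω)) =ᵐ[P]
      (moveEvent X Y τ i j y).indicator 1 := by
  filter_upwards [ae_nextTime hlam hC hC0 hN hXY hτ, ae_pathSolution hN hXY hC0] with ω hσ hs
  rw [randomNextHits, hs.measure_nextHits hlam hC hσ.2.1 hσ.1 hσ.2.2 hij]
  by_cases hω : ω ∈ moveEvent X Y τ i j y
  · rw [indicator_of_mem hω]
    exact if_pos hω
  · rw [indicator_of_notMem hω]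
    exact if_neg hω

lemma nullMeasurableSet_moveEvent (hlam : IsRate lam)
    (hC : ∀ i j, i ≠ j → ∀ y, 0 < y → rateInterval lam i j y ⊆ Ico 0 C) (hC0 : 0 ≤ C)
    (hN : IsPoissonRelTo N ℱ P) (hXY : IsStrongSolution lam N ℱ P X Y)
    (hτ : IsEssStopping ℱ P A τ) {i j : Fin k} (hij : i ≠ j) (y : ℝ) :
    NullMeasurableSet (moveEvent X Y τ i j y) P := by
  have h := ((aemeasurable_randomNextHits hlam hC hC0 hN hXY hτ hij
    (measurableSet_Iic (a := y))).congr (ae_count_eq_indicator hlam hC hC0 hN hXY hτ hij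
      y)).nullMeasurableSet_preimage (measurableSet_singleton 1)
  convert h using 1
  ext ω
  by_cases hω : ω ∈ moveEvent X Y τ i j y <;> simp [hω]

/-- The compensation formula turns the probability into a mean intensity, and Tonelli exchanges `ω`
with the age `s`, which is the elapsed time because `Y_τ = 0`. The measurable versions `S` and `D`
are there for the exchange, since the state and the waiting time are only measurable up to null
sets. -/
lemma measure_moveEvent_eq_lintegral (hlam : IsRate lam)
    (hC : ∀ i j, i ≠ j → ∀ y, 0 < y → rateInterval lam i j y ⊆ Ico 0 C) (hC0 : 0 ≤ C)
    (hN : IsPoissonRelTo N ℱ P) (hXY : IsStrongSolution lam N ℱ P X Y)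
    (hτ : IsEssStopping ℱ P A τ) (hY : ∀ᵐ ω ∂P, Y (τ ω) ω = 0) {i j : Fin k} (hij : i ≠ j)
    {S : Set Ω} (hS : MeasurableSet S) (hSi : S =ᵐ[P] {ω | X (τ ω) ω = i}) {D : Ω → ℝ}
    (hD : Measurable D) (hDτ : D =ᵐ[P] fun ω => (nextTime X τ ω : ℝ) - τ ω) (y : ℝ) :
    P (moveEvent X Y τ i j y) =
      ∫⁻ s in Ioc 0 y, ENNReal.ofReal (posRate lam i j s) * P (S ∩ {ω | s ≤ D ω}) := by
  classical
  have hcount := ae_count_eq_indicator hlam hC hC0 hN hXY hτ hij y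
  set f : ℝ → ℝ≥0∞ := (Ioc 0 y).indicator fun s => ENNReal.ofReal (posRate lam i j s) with hf
  have hfm : Measurable f :=
    (measurable_posRate hlam hij).ennreal_ofReal.indicator measurableSet_Ioc
  set V : Set (Ω × ℝ) := {q | q.1 ∈ S ∧ q.2 ≤ D q.1} with hV
  have hVm : MeasurableSet V :=
    (measurable_fst hS).inter (measurableSet_le measurable_snd (hD.comp measurable_fst))
  rw [← lintegral_indicator_one₀ (nullMeasurableSet_moveEvent hlam hC hC0 hN hXY hτ hij y),
    ← lintegral_congr_ae hcount, lintegral_randomNextHits hlam hC hC0 hN hXY hτ hij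
      measurableSet_Iic]
  calc ∫⁻ ω, intensity (randomNextHits lam X Y τ i j (Iic y) ω) ∂P
      = ∫⁻ ω, ∫⁻ s, f s * V.indicator 1 (ω, s) ∂volume ∂P := by
        refine lintegral_congr_ae ?_
        filter_upwards [ae_nextTime hlam hC hC0 hN hXY hτ, ae_pathSolution hN hXY hC0, hY, hDτ,
          hSi.mem_iff, ae_measurableSet_randomNextHits hlam hC hC0 hN hXY hτ hij
            (measurableSet_Iic (a := y))] with ω hσ hs hY0 hDω hSω hm
        rw [randomNextHits, intensity_nextHits hlam hC hs (L := Iic (D ω)) _ hm]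
        · split_ifs with hi
          · refine lintegral_congr fun s => ?_
            rw [hY0]
            simp only [zero_add]
            by_cases hsD : s ≤ D ω
            · have hmem : (ω, s) ∈ V := ⟨hSω.2 hi, hsD⟩
              rw [indicator_of_mem hmem, Pi.one_apply, mul_one, hf]
              by_cases hsy : s ∈ Ioc 0 y
              · have hmem' : s ∈ Ioi 0 ∩ Iic (D ω) ∩ {s | s ∈ Iic y} := ⟨⟨hsy.1, hsD⟩, hsy.2⟩
                rw [indicator_of_mem hsy, indicator_of_mem hmem', posRate_of_pos hsy.1]
              · rw [indicator_of_notMem hsy, indicator_of_notMem]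
                exact fun h => hsy ⟨h.1.1, h.2⟩
            · have hmem : (ω, s) ∉ V := fun h => hsD h.2
              rw [indicator_of_notMem hmem, mul_zero, indicator_of_notMem]
              exact fun h => hsD h.1.2
          · symm
            rw [lintegral_eq_zero_iff' (by
              exact (hfm.mul ((measurable_one.indicator hVm).comp
                measurable_prodMk_left)).aemeasurable)]
            refine Eventually.of_forall fun s => ?_
            have hmem : (ω, s) ∉ V := fun h => hi (hSω.1 h.1)
            simp [indicator_of_notMem hmem]
        · intro u hu
          rw [mem_Iic, hDω, sub_le_sub_iff_right, NNReal.coe_le_coe]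
          constructor
          · intro h
            by_contra hlt
            exact h _ ⟨hσ.2.1, not_le.1 hlt⟩ hσ.1
          · exact fun h v hv => hσ.2.2 v ⟨hv.1, hv.2.trans_le h⟩
    _ = ∫⁻ s, ∫⁻ ω, f s * V.indicator 1 (ω, s) ∂P ∂volume := by
        refine lintegral_lintegral_swap ?_
        exact ((hfm.comp measurable_snd).mul (measurable_one.indicator hVm)).aemeasurable
    _ = ∫⁻ s in Ioc 0 y, ENNReal.ofReal (posRate lam i j s) * P (S ∩ {ω | s ≤ D ω}) := by
        rw [← lintegral_indicator measurableSet_Ioc]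
        refine lintegral_congr fun s => ?_
        have hVs : Measurable fun ω => V.indicator (1 : Ω × ℝ → ℝ≥0∞) (ω, s) :=
          (measurable_one.indicator hVm).comp measurable_prodMk_right
        rw [lintegral_const_mul _ hVs]
        have h1 : ∫⁻ ω, V.indicator 1 (ω, s) ∂P = P (S ∩ {ω | s ≤ D ω}) := by
          rw [← lintegral_indicator_one (hS.inter (measurableSet_le measurable_const hD))]
          rfl
        rw [h1, hf]
        by_cases hs : s ∈ Ioc 0 y <;> simp [hs]

lemma measureReal_moveEvent_eq_integral (hlam : IsRate lam)
    (hC : ∀ i j, i ≠ j → ∀ y, 0 < y → rateInterval lam i j y ⊆ Ico 0 C) (hC0 : 0 ≤ C)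
    (hN : IsPoissonRelTo N ℱ P) (hXY : IsStrongSolution lam N ℱ P X Y)
    (hτ : IsEssStopping ℱ P A τ) (hY : ∀ᵐ ω ∂P, Y (τ ω) ω = 0) {i j : Fin k} (hij : i ≠ j)
    {S : Set Ω} (hS : MeasurableSet S) (hSi : S =ᵐ[P] {ω | X (τ ω) ω = i}) {D : Ω → ℝ}
    (hD : Measurable D) (hDτ : D =ᵐ[P] fun ω => (nextTime X τ ω : ℝ) - τ ω) {y : ℝ} (hy : 0 ≤ y)
    (hG : Measurable fun s => P.real (S ∩ {ω | s ≤ D ω})) :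
    P.real (moveEvent X Y τ i j y) =
      ∫ s in (0 : ℝ)..y, posRate lam i j s * P.real (S ∩ {ω | s ≤ D ω}) := by
  rw [measureReal_def, measure_moveEvent_eq_lintegral hlam hC hC0 hN hXY hτ hY hij hS hSi hD hDτ,
    intervalIntegral.integral_of_le hy, integral_eq_lintegral_of_nonneg_ae
      (Eventually.of_forall fun s => mul_nonneg (posRate_nonneg hlam hij s) measureReal_nonneg)
      ((measurable_posRate hlam hij).mul hG).aestronglyMeasurable]
  congr 1
  refine lintegral_congr fun s => ?_
  rw [ENNReal.ofReal_mul (posRate_nonneg hlam hij s), ofReal_measureReal]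

/-- The next transition leaves `i` for exactly one other state, at an age equal to the waiting time.
This closes the system of identities into one equation for the survival function. -/
lemma sum_measureReal_moveEvent (hlam : IsRate lam)
    (hC : ∀ i j, i ≠ j → ∀ y, 0 < y → rateInterval lam i j y ⊆ Ico 0 C) (hC0 : 0 ≤ C)
    (hN : IsPoissonRelTo N ℱ P) (hXY : IsStrongSolution lam N ℱ P X Y)
    (hτ : IsEssStopping ℱ P A τ) (hY : ∀ᵐ ω ∂P, Y (τ ω) ω = 0) {i : Fin k}
    {S : Set Ω} (hSi : S =ᵐ[P] {ω | X (τ ω) ω = i}) {D : Ω → ℝ}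
    (hDτ : D =ᵐ[P] fun ω => (nextTime X τ ω : ℝ) - τ ω) (y : ℝ) :
    ∑ j ∈ Finset.univ.filter (fun j => j ≠ i), P.real (moveEvent X Y τ i j y) =
      P.real (S ∩ {ω | D ω ≤ y}) := by
  have hU : (⋃ j ∈ Finset.univ.filter (fun j => j ≠ i), moveEvent X Y τ i j y) =ᵐ[P]
      (S ∩ {ω | D ω ≤ y} : Set Ω) := by
    filter_upwards [ae_nextTime hlam hC hC0 hN hXY hτ, ae_pathSolution hN hXY hC0, hY, hDτ,
      hSi.mem_iff] with ω hσ hs hY0 hDω hSω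
    have hleft := hs.leftLim_of_no_transition hlam hC hσ.2.1 hσ.2.2
    have hleft' : Function.leftLim (fun t => Y t ω) (nextTime X τ ω) = D ω := by
      rw [hleft.2, hY0, zero_add, hDω]
    refine propext ⟨fun h => ?_, fun h => ?_⟩
    · obtain ⟨j, -, hi, -, hle⟩ := mem_iUnion₂.1 h
      exact ⟨hSω.2 hi, hleft'.symm.trans_le hle⟩
    · have hi : X (τ ω) ω = i := hSω.1 h.1
      refine mem_iUnion₂.2 ⟨X (nextTime X τ ω) ω, ?_, hi, rfl, hleft'.trans_le h.2⟩
      refine Finset.mem_filter.2 ⟨Finset.mem_univ _, fun heq => hσ.1.2 ?_⟩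
      rw [hleft.1, hi]
      exact heq
  rw [measureReal_def, ← measure_congr hU, measure_biUnion_finset₀, ENNReal.toReal_sum]
  · rfl
  · exact fun _ _ => measure_ne_top _ _
  · intro j _ l _ hjl
    refine Disjoint.aedisjoint (Set.disjoint_left.2 fun ω h1 h2 => hjl ?_)
    exact h1.2.1.symm.trans h2.2.1
  · exact fun j hj => nullMeasurableSet_moveEvent hlam hC hC0 hN hXY hτ
      (Finset.mem_filter.1 hj).2.symm y

lemma measureReal_moveEvent (hlam : IsRate lam)
    (hC : ∀ i j, i ≠ j → ∀ y, 0 < y → rateInterval lam i j y ⊆ Ico 0 C) (hC0 : 0 ≤ C)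
    (hN : IsPoissonRelTo N ℱ P) (hXY : IsStrongSolution lam N ℱ P X Y)
    (hτ : IsEssStopping ℱ P A τ) (hY : ∀ᵐ ω ∂P, Y (τ ω) ω = 0) {i j : Fin k} (hij : i ≠ j)
    {y : ℝ} (hy : 0 < y) :
    P.real (moveEvent X Y τ i j y) = P.real {ω | X (τ ω) ω = i} *
      ∫ s in (0 : ℝ)..y, Real.exp (-cumRate lam i s) * lam i j s := by
  obtain ⟨S, -, hS, hSi⟩ :=
    (nullMeasurableSet_state hC0 hN hXY hτ i).exists_measurable_superset_ae_eq
  have hDm : AEMeasurable (fun ω => (nextTime X τ ω : ℝ) - τ ω) P :=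
    (isEssStopping_nextTime hlam hC hC0 hN hXY hτ).aemeasurable.coe_nnreal_real.sub
      hτ.aemeasurable.coe_nnreal_real
  obtain ⟨D, hD, hDτ'⟩ := hDm
  have hDτ := hDτ'.symm
  set G : ℝ → ℝ := fun s => P.real (S ∩ {ω | s ≤ D ω}) with hGdef
  have hGanti : Antitone G := fun s t hst =>
    measureReal_mono (inter_subset_inter_right _ fun ω (hω : t ≤ D ω) => hst.trans hω)
  have hGm : Measurable G := hGanti.measurable
  have hGb : ∀ s, |G s| ≤ 1 := fun s => by
    rw [abs_of_nonneg measureReal_nonneg]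
    exact measureReal_le_one
  have hmove : ∀ l, i ≠ l → ∀ v, 0 ≤ v →
      P.real (moveEvent X Y τ i l v) = ∫ s in (0 : ℝ)..v, posRate lam i l s * G s :=
    fun l hl v hv => measureReal_moveEvent_eq_integral hlam hC hC0 hN hXY hτ hY hl hS hSi hD hDτ
      hv hGm
  obtain ⟨b, hb⟩ := exists_exitRate_le hlam i
  set r := exitRate (posRate lam) i with hr
  have hrm : Measurable r := measurable_exitRate_posRate hlam i
  have hrGb : ∀ s, |r s * G s| ≤ b := fun s => by
    rw [abs_mul]
    exact (mul_le_mul (hb s) (hGb s) (abs_nonneg _) b.2).trans_eq (mul_one _)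
  have hsum : ∀ v, 0 ≤ v → ∫ s in (0 : ℝ)..v, r s * G s = P.real (S ∩ {ω | D ω ≤ v}) := by
    intro v hv
    rw [← sum_measureReal_moveEvent hlam hC hC0 hN hXY hτ hY hSi hDτ v,
      Finset.sum_congr rfl fun l hl => hmove l (Finset.mem_filter.1 hl).2.symm v hv,
      ← intervalIntegral.integral_finsetSum]
    · simp_rw [hr, exitRate, Finset.sum_mul]
    · intro l hl
      have hil : i ≠ l := (Finset.mem_filter.1 hl).2.symm
      refine intervalIntegrable_of_bounded (b := b) ((measurable_posRate hlam hil).mul hGm)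
        (fun s => le_trans ?_ (hrGb s)) 0 v
      rw [Pi.mul_apply, abs_mul, abs_mul, abs_of_nonneg (posRate_nonneg hlam hil s)]
      gcongr
      exact (posRate_le_exitRate hlam hil s).trans (le_abs_self _)
  set W : ℝ → ℝ := fun v => P.real S - ∫ s in (0 : ℝ)..v, r s * G s with hW
  have hWeq : ∀ v, 0 ≤ v → W v = P.real (S ∩ {ω | v < D ω}) := by
    intro v hv
    have h := measureReal_inter_add_sdiff (μ := P) (s := S)
      (measurableSet_le hD (measurable_const (a := v)))
    have h2 : S \ {ω | D ω ≤ v} = S ∩ {ω | v < D ω} := by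
      ext ω
      simp
    rw [h2] at h
    rw [hW]
    simp only
    rw [hsum v hv]
    linarith
  have hWcont : Continuous W :=
    continuous_const.sub (lipschitzWith_integral (hrm.mul hGm) hrGb).continuous
  -- `G` counts `v ≤ D` but `W` counts `v < D`; continuity of `W` from the left shows that no mass
  -- sits at `v`.
  have hGW : ∀ v, 0 < v → G v = W v := by
    intro v hv
    refine le_antisymm ?_ ?_
    · refine ge_of_tendsto ((hWcont.tendsto v).mono_left (nhdsWithin_le_nhds (s := Iio v))) ?_
      filter_upwards [Ioo_mem_nhdsLT hv] with u hu
      rw [hWeq u hu.1.le]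
      exact measureReal_mono (inter_subset_inter_right _
        fun ω (hω : v ≤ D ω) => hu.2.trans_le hω)
    · rw [hWeq v hv.le]
      exact measureReal_mono (inter_subset_inter_right _ fun ω (hω : v < D ω) => hω.le)
  rw [hmove j hij y hy.le, ← measureReal_congr hSi, ← intervalIntegral.integral_const_mul]
  refine integral_congr_of_pos (fun s hs => ?_) le_rfl hy.le
  rw [eq_mul_exp_of_eq_sub_integral hrm hb hGm hGb hGW hs, cumRate_eq i hs.le, posRate_of_pos hs]
  ring

end

end AgeDependent

end

/-! ### Enumeration of the transitions and the kernel -/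

theorem mainTheorem8 {Ω : Type*} [mΩ : MeasurableSpace Ω] (P : Measure Ω) [IsProbabilityMeasure P]
    (ℱ : Filtration ℝ≥0 mΩ) {k : ℕ} (lam : Fin k → Fin k → ℝ → ℝ) (hlam : AgeDependent.IsRate lam)
    (N : Ω → Measure (ℝ≥0 × ℝ)) (hN : AgeDependent.IsPoissonRelTo N ℱ P)
    (X : ℝ≥0 → Ω → Fin k) (Y : ℝ≥0 → Ω → ℝ)
    (hXY : AgeDependent.IsStrongSolution lam N ℱ P X Y)
    (T : ℕ → Ω → ℝ≥0)
    (hT : T = fun n ω => AgeDependent.transitionTime (fun t => X t ω) n) :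
    (∀ᵐ ω ∂P, StrictMono (fun n => T n ω) ∧
      range (fun n => T (n + 1) ω) = AgeDependent.transitionSet (fun t => X t ω)) ∧
    ∀ n : ℕ, (1 ≤ n ∨ ∀ᵐ ω ∂P, Y 0 ω = 0) →
    ∀ i j : Fin k, i ≠ j → P {ω | X (T n ω) ω = i} ≠ 0 →
    ∀ y : ℝ, 0 < y →
      (P[|{ω | X (T n ω) ω = i}]).real
          {ω | X (T (n + 1) ω) ω = j ∧ Function.leftLim (fun t => Y t ω) (T (n + 1) ω) ≤ y} =
        ∫ s in (0 : ℝ)..y, Real.exp (-AgeDependent.cumRate lam i s) * lam i j s := by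
  obtain ⟨C, hC0, hC⟩ := AgeDependent.exists_rateBound hlam
  have hT0 : T 0 = fun _ => 0 := by rw [hT]; rfl
  have hTs : ∀ n, T (n + 1) = AgeDependent.nextTime X (T n) := fun n => by rw [hT]; rfl
  have hess : ∀ n, ∃ A, AgeDependent.IsEssStopping ℱ P A (T n) := by
    intro n
    induction n with
    | zero =>
      rw [hT0]
      exact ⟨fun _ => univ, fun _ => .univ,
        Eventually.of_forall fun _ _ => ⟨fun _ => mem_univ _, fun _ => zero_le⟩⟩
    | succ n ih =>
      obtain ⟨A, hA⟩ := ih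
      rw [hTs]
      exact ⟨_, AgeDependent.isEssStopping_nextTime hlam hC hC0.le hN hXY hA⟩
  have hnext : ∀ᵐ ω ∂P, ∀ n, T (n + 1) ω ∈ AgeDependent.transitionSet (fun t => X t ω) ∧
      T n ω < T (n + 1) ω ∧
      ∀ u ∈ Ioo (T n ω) (T (n + 1) ω), u ∉ AgeDependent.transitionSet (fun t => X t ω) :=
    ae_all_iff.2 fun n => by
      obtain ⟨A, hA⟩ := hess n
      rw [hTs]
      exact AgeDependent.ae_nextTime hlam hC hC0.le hN hXY hA
  have hsol := AgeDependent.ae_pathSolution hN hXY hC0.le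
  refine ⟨?_, fun n hn i j hij hPi y hy => ?_⟩
  · filter_upwards [hnext, hsol] with ω hω hs
    have hmono : StrictMono fun n => T n ω := strictMono_nat_of_lt_succ fun n => (hω n).2.1
    refine ⟨hmono, Subset.antisymm (range_subset_iff.2 fun n => (hω n).1) fun t ht => ?_⟩
    by_contra hnot
    -- A transition time missed by the enumeration would lie beyond every `T n`, leaving infinitely
    -- many transitions before it.
    have hlt : ∀ n, T n ω < t := by
      intro n
      induction n with
      | zero =>
        rw [hT0]
        exact ht.1
      | succ n ih =>
        refine lt_of_le_of_ne ?_ fun h => hnot ⟨n, h⟩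
        by_contra hgt
        exact (hω n).2.2 t ⟨ih, not_le.1 hgt⟩ ht
    exact Set.infinite_of_injective_forall_mem (f := fun n => T (n + 1) ω)
      (s := AgeDependent.transitionSet (fun t => X t ω) ∩ Iic t)
      (fun m n hmn => by simpa using hmono.injective hmn)
      (fun n => ⟨(hω n).1, (hlt (n + 1)).le⟩) (hs.finite_transitionSet hC t)
  · obtain ⟨A, hA⟩ := hess n
    have hY : ∀ᵐ ω ∂P, Y (T n ω) ω = 0 := by
      -- Age zero at `T n` is the hypothesis when `n = 0` and the reset at a transition otherwise.
      rcases n with _ | n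
      · rw [hT0]
        exact hn.resolve_left (by omega)
      · filter_upwards [hnext, hsol] with ω hω hs
        exact hs.age_eq_zero hlam hC (hω n).1
    have hnull := AgeDependent.nullMeasurableSet_state hC0.le hN hXY hA i
    have hmove := AgeDependent.measureReal_moveEvent hlam hC hC0.le hN hXY hA hY hij hy
    have hset : {ω | X (T (n + 1) ω) ω = j ∧
        Function.leftLim (fun t => Y t ω) (T (n + 1) ω) ≤ y} ∩ {ω | X (T n ω) ω = i} =
        AgeDependent.moveEvent X Y (T n) i j y := by
      rw [hTs]
      ext ω
      simp only [AgeDependent.moveEvent, mem_inter_iff, mem_ofPred_eq]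
      tauto
    have hpos : P.real {ω | X (T n ω) ω = i} ≠ 0 := by
      rw [measureReal_def]
      exact ENNReal.toReal_ne_zero.2 ⟨hPi, measure_ne_top _ _⟩
    rw [ProbabilityTheory.cond, measureReal_def, Measure.smul_apply,
      Measure.restrict_apply₀' hnull, hset, smul_eq_mul, ENNReal.toReal_mul, ENNReal.toReal_inv,
      ← measureReal_def, ← measureReal_def, hmove, inv_mul_cancel_left₀ hpos]
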